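/- Let $\varepsilon>0$ and let $u=u(x,t)$, $x\in\mathbb{R}$, $t\ge 0$, be a real-valued solution (in the sense of distributions) of the sine-Gordon equation $\varepsilon^2u_{tt}-\varepsilon^2u_{xx}+\sin(u)=0$ with $L^1$-Sobolev regularity: for every $t\ge 0$ the functions $1-\cos(u)$, $\sin(u)$, $u_x$, $u_{xx}$, $u_t$, $u_{tx}$ (derivatives in the sense of distributions) lie in $L^1(\mathbb{R})$ as functions of $x$, and $u(\cdot,t)$ denotes its continuous representative. Fix $t\ge 0$ and write $f=u(\cdot,t)$, $g=\varepsilon u_t(\cdot,t)$. For $z\in\mathbb{C}\setminus\{0\}$ let $E=E(z)=\frac14(z-z^{-1})$, $\sigma_3=\mathrm{diag}(1,-1)$ and $$\mathbf{Q}(x;z)=\begin{bmatrix} z^{-1}(1-\cos f) & -z^{-1}\sin f-i(\varepsilon f'+g)\\ -z^{-1}\sin f+i(\varepsilon f'+g) & -z^{-1}(1-\cos f)\end{bmatrix}.$$ Let $\mathbf{m}_1^\pm(x;z),\mathbf{m}_2^\pm(x;z)$ be the columns of the matrices $\mathbf{M}^\pm$ determined, as bounded continuous functions of $x$, by $$\mathbf{M}^+(x)=\mathbb{I}-\frac{1}{4i\varepsilon}\int_x^{+\infty}e^{-iE(x-y)\sigma_3/\varepsilon}\mathbf{Q}(y)\mathbf{M}^+(y)e^{iE(x-y)\sigma_3/\varepsilon}\,dy,$$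 $$\mathbf{M}^-(x)=\mathbb{I}+\frac{1}{4i\varepsilon}\int_{-\infty}^{x}e^{-iE(x-y)\sigma_3/\varepsilon}\mathbf{Q}(y)\mathbf{M}^-(y)e^{iE(x-y)\sigma_3/\varepsilon}\,dy,$$ where $\mathbf{m}_1^-,\mathbf{m}_2^+$ are defined for $\Im(z)\ge0$ and $\mathbf{m}_1^+,\mathbf{m}_2^-$ for $\Im(z)\le 0$. Let $\mathbf{j}_1^\pm=\mathbf{m}_1^\pm e^{-iEx/\varepsilon}$ and $\mathbf{j}_2^\pm=\mathbf{m}_2^\pm e^{iEx/\varepsilon}$ be the Jost solutions, and let $S_{11}(z)=\det[\mathbf{j}_1^+,\mathbf{j}_2^-]$ ($\Im(z)\le0$) and $S_{22}(z)=\det[\mathbf{j}_1^-,\mathbf{j}_2^+]$ ($\Im(z)\ge0$) be the diagonal scattering coefficients (these Wronskians do not depend on $x$). Define $$\mathbf{G}(z)=\begin{cases}\left[S_{22}(z)^{-1}\mathbf{m}_1^-(x;z),\ \mathbf{m}_2^+(x;z)\right], & \Im(z)>0,\\ \left[\mathbf{m}_1^+(x;z),\ S_{11}(z)^{-1}\mathbf{m}_2^-(x;z)\right],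 & \Im(z)<0.\end{cases}$$ Then for every $x\in\mathbb{R}$ and $t\ge0$ the limit $\mathbf{G}^{(0)}:=\lim_{z\to0,\ \Im(z)\ne0}\mathbf{G}(z)$ exists, and $$\cos(u(x,t))=G^{(0)}_{11}G^{(0)}_{22}+G^{(0)}_{12}G^{(0)}_{21}=1+2G^{(0)}_{12}G^{(0)}_{21},$$ $$\sin(u(x,t))=2G^{(0)}_{21}G^{(0)}_{22}=-2G^{(0)}_{11}G^{(0)}_{12}.$$ -/

import Mathlib

open scoped ContDiff

noncomputable section

namespace SineGordon

/-! ### Distributional derivatives and `L¹`-Sobolev solutions -/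

/-- Test functions on the line. -/
def IsTest (φ : ℝ → ℝ) : Prop := ContDiff ℝ ∞ φ ∧ HasCompactSupport φ

/-- `v` is the derivative of `w` in the sense of distributions on the line. -/
def HasWeakDeriv (w v : ℝ → ℝ) : Prop :=
  MeasureTheory.LocallyIntegrable w ∧ MeasureTheory.LocallyIntegrable v ∧
    ∀ φ : ℝ → ℝ, IsTest φ → ∫ x, w x * deriv φ x = -∫ x, v x * φ x

/-- `v` is the time derivative at time `t ≥ 0` of the distribution-valued map `s ↦ u(·, s)`,
`s ∈ [0, ∞)` (a one-sided derivative at `t = 0`). -/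
def HasDistribTimeDeriv (u : ℝ → ℝ → ℝ) (v : ℝ → ℝ) (t : ℝ) : Prop :=
  ∀ φ : ℝ → ℝ, IsTest φ →
    HasDerivWithinAt (fun s => ∫ x, u x s * φ x) (∫ x, v x * φ x) (Set.Ici 0) t

/-- `u`, with time derivative `ut`, solves `ε² u_tt - ε² u_xx + sin u = 0` for `t > 0` in the
sense of distributions: `ε² ∂ₜ⟨u_t, φ⟩ = ε² ⟨u, φ''⟩ - ⟨sin u, φ⟩` for all test functions. -/
def IsSineGordonSolution (ε : ℝ) (u ut : ℝ → ℝ → ℝ) : Prop :=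
  (∀ t, 0 ≤ t → HasDistribTimeDeriv u (fun x => ut x t) t) ∧
  ∀ t, 0 < t → ∀ φ : ℝ → ℝ, IsTest φ →
    HasDerivAt (fun s => ε ^ 2 * ∫ x, ut x s * φ x)
      (ε ^ 2 * (∫ x, u x t * iteratedDeriv 2 φ x) - ∫ x, Real.sin (u x t) * φ x) t

/-- `L¹`-Sobolev regularity of `u`: for all `t ≥ 0`, the functions `1 - cos u`, `sin u`, `u_x`,
`u_xx`, `u_t`, `u_tx` (derivatives in the sense of distributions) are in `L¹(ℝ)` as functions
of `x`. Since `u_x(·, t) ∈ L¹`, the function `u(·, t)` is a.e. equal to a unique continuous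
function; `u(·, t)` denotes this representative, so that its point values are meaningful. -/
structure HasL1SobolevRegularity (u ux uxx ut utx : ℝ → ℝ → ℝ) : Prop where
  continuous : ∀ t, 0 ≤ t → Continuous fun x => u x t
  hasDeriv_x : ∀ t, 0 ≤ t → HasWeakDeriv (fun x => u x t) (fun x => ux x t)
  hasDeriv_xx : ∀ t, 0 ≤ t → HasWeakDeriv (fun x => ux x t) (fun x => uxx x t)
  hasDeriv_t : ∀ t, 0 ≤ t → HasDistribTimeDeriv u (fun x => ut x t) t
  hasDeriv_tx : ∀ t, 0 ≤ t → HasWeakDeriv (fun x => ut x t) (fun x => utx x t)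
  integrable_one_sub_cos :
    ∀ t, 0 ≤ t → MeasureTheory.Integrable fun x => 1 - Real.cos (u x t)
  integrable_sin : ∀ t, 0 ≤ t → MeasureTheory.Integrable fun x => Real.sin (u x t)
  integrable_x : ∀ t, 0 ≤ t → MeasureTheory.Integrable fun x => ux x t
  integrable_xx : ∀ t, 0 ≤ t → MeasureTheory.Integrable fun x => uxx x t
  integrable_t : ∀ t, 0 ≤ t → MeasureTheory.Integrable fun x => ut x t
  integrable_tx : ∀ t, 0 ≤ t → MeasureTheory.Integrable fun x => utx x t

/-! ### The scattering problem

The potentials at a fixed time are `f = u`, `f' = u_x` and `g = ε u_t`. -/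

/-- `E(z) = (z - 1/z) / 4`. -/
def E (z : ℂ) : ℂ := (z - z⁻¹) / 4

/-- The decaying part `Q(x; z)` of the coefficient matrix in
`4 i ε J_x = (4 E σ₃ + Q) J`. -/
def Q (ε : ℝ) (f f' g : ℝ → ℝ) (z : ℂ) (x : ℝ) : Matrix (Fin 2) (Fin 2) ℂ :=
  let c : ℂ := z⁻¹ * ((1 - Real.cos (f x) : ℝ) : ℂ)
  let s : ℂ := z⁻¹ * ((Real.sin (f x) : ℝ) : ℂ)
  let d : ℂ := Complex.I * ((ε * f' x + g x : ℝ) : ℂ)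
  !![c, -s - d; -s + d, -c]

/-- `e^{a σ₃}`. -/
def expSigma (a : ℂ) : Matrix (Fin 2) (Fin 2) ℂ :=
  !![Complex.exp a, 0; 0, Complex.exp (-a)]

/-- For a column `m` with index `k` of a matrix function `M`, the same column of
`e^{-iE(x-y)σ₃/ε} Q(y) M(y) e^{iE(x-y)σ₃/ε}`. -/
def integrand (ε : ℝ) (f f' g : ℝ → ℝ) (z : ℂ) (k : Fin 2) (m : ℝ → Fin 2 → ℂ) (x y : ℝ) :
    Fin 2 → ℂ :=
  let a : ℂ := Complex.I * E z * ((x - y : ℝ) : ℂ) / (ε : ℂ)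
  expSigma a k k • (expSigma (-a)).mulVec ((Q ε f f' g z y).mulVec (m y))

/-- `m` is a bounded continuous solution of the `k`-th column of
`M⁺(x) = I - (4iε)⁻¹ ∫_x^∞ e^{-iE(x-y)σ₃/ε} Q(y) M⁺(y) e^{iE(x-y)σ₃/ε} dy`. -/
def IsMPlus (ε : ℝ) (f f' g : ℝ → ℝ) (z : ℂ) (k : Fin 2) (m : ℝ → Fin 2 → ℂ) : Prop :=
  Continuous m ∧ (∃ C : ℝ, ∀ x, ‖m x‖ ≤ C) ∧
    ∀ x, m x = Pi.single k 1 -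
      (4 * Complex.I * (ε : ℂ))⁻¹ • ∫ y in Set.Ioi x, integrand ε f f' g z k m x y

/-- `m` is a bounded continuous solution of the `k`-th column of
`M⁻(x) = I + (4iε)⁻¹ ∫_{-∞}^x e^{-iE(x-y)σ₃/ε} Q(y) M⁻(y) e^{iE(x-y)σ₃/ε} dy`. -/
def IsMMinus (ε : ℝ) (f f' g : ℝ → ℝ) (z : ℂ) (k : Fin 2) (m : ℝ → Fin 2 → ℂ) : Prop :=
  Continuous m ∧ (∃ C : ℝ, ∀ x, ‖m x‖ ≤ C) ∧
    ∀ x, m x = Pi.single k 1 +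
      (4 * Complex.I * (ε : ℂ))⁻¹ • ∫ y in Set.Iic x, integrand ε f f' g z k m x y

/-- The columns of `M⁺`: the bounded solution of the integral equation. Column `0` is meaningful
for `Im z ≤ 0` and column `1` for `Im z ≥ 0` (`z ≠ 0`). -/
def mPlus (ε : ℝ) (f f' g : ℝ → ℝ) (k : Fin 2) (z : ℂ) : ℝ → Fin 2 → ℂ :=
  Classical.epsilon (IsMPlus ε f f' g z k)

/-- The columns of `M⁻`: the bounded solution of the integral equation. Column `0` is meaningful
for `Im z ≥ 0` and column `1` for `Im z ≤ 0` (`z ≠ 0`). -/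
def mMinus (ε : ℝ) (f f' g : ℝ → ℝ) (k : Fin 2) (z : ℂ) : ℝ → Fin 2 → ℂ :=
  Classical.epsilon (IsMMinus ε f f' g z k)

/-- The columns of the Jost matrix `J⁺ = M⁺ e^{-iExσ₃/ε}`. -/
def jPlus (ε : ℝ) (f f' g : ℝ → ℝ) (k : Fin 2) (z : ℂ) (x : ℝ) : Fin 2 → ℂ :=
  expSigma (-(Complex.I * E z * (x : ℂ) / (ε : ℂ))) k k • mPlus ε f f' g k z x

/-- The columns of the Jost matrix `J⁻ = M⁻ e^{-iExσ₃/ε}`. -/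
def jMinus (ε : ℝ) (f f' g : ℝ → ℝ) (k : Fin 2) (z : ℂ) (x : ℝ) : Fin 2 → ℂ :=
  expSigma (-(Complex.I * E z * (x : ℂ) / (ε : ℂ))) k k • mMinus ε f f' g k z x

/-- The matrix `[a, b]` with columns `a` and `b`. -/
def cols (a b : Fin 2 → ℂ) : Matrix (Fin 2) (Fin 2) ℂ := !![a 0, b 0; a 1, b 1]

/-- Where all four columns exist (`z` real), the scattering matrix `S` is defined by `J⁺ = J⁻ S`,
and `det J⁻ = 1`; then its diagonal entries are Wronskians of the columns. -/
theorem diag_eq_wronskian (Jp Jm S : Matrix (Fin 2) (Fin 2) ℂ) (h : Jp = Jm * S)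
    (hd : Jm.det = 1) :
    S 0 0 = (cols (fun i => Jp i 0) (fun i => Jm i 1)).det ∧
      S 1 1 = (cols (fun i => Jm i 0) (fun i => Jp i 1)).det := by
  subst h
  rw [Matrix.det_fin_two] at hd
  constructor
  · simp only [cols, Matrix.det_fin_two_of, Matrix.mul_apply, Fin.sum_univ_two]
    linear_combination -(S 0 0) * hd
  · simp only [cols, Matrix.det_fin_two_of, Matrix.mul_apply, Fin.sum_univ_two]
    linear_combination -(S 1 1) * hd

/-- The entry `S₁₁(z) = det [j₁⁺(x; z), j₂⁻(x; z)]` of the scattering matrix, continued to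
`Im z ≤ 0` by this formula. The Wronskian of two solutions of the (trace-free) linear system
does not depend on `x`; it is evaluated at `x = 0`. -/
def S11 (ε : ℝ) (f f' g : ℝ → ℝ) (z : ℂ) : ℂ :=
  (cols (jPlus ε f f' g 0 z 0) (jMinus ε f f' g 1 z 0)).det

/-- The entry `S₂₂(z) = det [j₁⁻(x; z), j₂⁺(x; z)]` of the scattering matrix, continued to
`Im z ≥ 0` by this formula (evaluated at `x = 0`, as for `S11`). -/
def S22 (ε : ℝ) (f f' g : ℝ → ℝ) (z : ℂ) : ℂ :=
  (cols (jMinus ε f f' g 0 z 0) (jPlus ε f f' g 1 z 0)).det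

/-- The matrix `G(z; x)`, which is meaningful for `Im z ≠ 0`:
`[S₂₂⁻¹ m₁⁻, m₂⁺]` for `Im z > 0` and `[m₁⁺, S₁₁⁻¹ m₂⁻]` for `Im z < 0`. -/
def G (ε : ℝ) (f f' g : ℝ → ℝ) (x : ℝ) (z : ℂ) : Matrix (Fin 2) (Fin 2) ℂ :=
  if 0 < z.im then
    cols ((S22 ε f f' g z)⁻¹ • mMinus ε f f' g 0 z x) (mPlus ε f f' g 1 z x)
  else
    cols (mPlus ε f f' g 0 z x) ((S11 ε f f' g z)⁻¹ • mMinus ε f f' g 1 z x)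

end SineGordon

end

noncomputable section

namespace SineGordon

open MeasureTheory Set Filter Topology

/-! ### Primitives on half-lines -/

/-! The `z⁻¹` part of `4 E σ₃ + Q` is `-z⁻¹` times the reflection matrix `[cos f, sin f; sin f, -cos
f]`, which a rotation by `f / 2` diagonalizes. In that rotating frame the first column of `M⁻`
becomes a pair `(P, R)` whose system has only one singular coefficient: the damping rate `w = 2iE/ε`
of `R`, with `Re w ≤ 0` for `Im z > 0` and `w → ∞` as `z → 0`. All other coefficients are `O(z)`
(written `ν`), except the real antisymmetric coupling `b = f'/4 - g/(4ε)` between `P` and `R`.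

The coupling `b` drops out of the energy `|P|² + |R|²` and `w` can only decrease it, so `(P, R)` is
bounded uniformly in `z`. A large `w` then forces `R → 0`: for merely integrable `b` this is a
Riemann-Lebesgue argument, with `b` replaced by a smooth compactly supported function and one
integration by parts. Once `R → 0`, `P' → 0` in `L¹`, so `P` tends to its value at `-∞`. This is
`IsRotatedSystem.tendsto_const`. Since `1 - cos f` and `f'` are integrable, `f` tends to a multiple
of `2π`, and that value is a sign `A = cos(f(-∞)/2)`. Undoing the rotation, `m₁⁻ → A (cos(f/2),
sin(f/2))`.

The other columns follow from two symmetries under `z ↦ -z`: a quarter turn exchanges the columns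
(`isMMinus_quarterTurn_iff`), and reflection in space exchanges `M⁺` and `M⁻`
(`isMMinus_reflect_iff`). With `C` the sign at `+∞`, both `S₁₁` and `S₂₂` tend to `AC`. Dividing by
them turns the sign `A` into `C`, so from either half-plane `G` tends to `C` times the rotation by
`f / 2`. The formulas for `u` are then double-angle identities, in which `C² = 1`. -/

theorem hasDerivAt_integral_Iic {F : Type*} [NormedAddCommGroup F] [NormedSpace ℝ F]
    [CompleteSpace F] {v : ℝ → F} (hc : Continuous v) (hi : ∀ x, IntegrableOn v (Iic x)) (x : ℝ) :
    HasDerivAt (fun x => ∫ y in Iic x, v y) (v x) x := by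
  have h : (fun x => ∫ y in Iic x, v y) = fun x => (∫ y in Iic 0, v y) + ∫ y in (0 : ℝ)..x, v y := by
    funext x
    rw [← intervalIntegral.integral_Iic_sub_Iic (hi 0) (hi x)]
    abel
  rw [h]
  exact (hc.integral_hasStrictDerivAt 0 x).hasDerivAt.const_add _

theorem continuous_integral_Iic {v : ℝ → ℝ} (hi : Integrable v) :
    Continuous fun x => ∫ y in Iic x, v y := by
  have h : (fun x => ∫ y in Iic x, v y) = fun x => (∫ y in Iic 0, v y) + ∫ y in (0 : ℝ)..x, v y := by
    funext x
    rw [← intervalIntegral.integral_Iic_sub_Iic hi.integrableOn hi.integrableOn]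
    abel
  rw [h]
  exact continuous_const.add (intervalIntegral.continuous_primitive
    (fun a b => hi.intervalIntegrable) 0)

/-! ### Weak derivatives -/

theorem isTest_deriv {φ : ℝ → ℝ} (hφ : IsTest φ) : IsTest (deriv φ) :=
  ⟨(contDiff_infty_iff_deriv.1 hφ.1).2, hφ.2.deriv⟩

theorem IsTest.integrable {φ : ℝ → ℝ} (hφ : IsTest φ) : Integrable φ :=
  hφ.1.continuous.integrable_of_hasCompactSupport hφ.2

/-- Fubini on the region `y ≤ x`: the inner integral of `φ'` over `[y, ∞)` is `-φ(y)`. -/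
theorem integral_primitive_mul_deriv {v φ : ℝ → ℝ} (hv : Integrable v) (hφ : IsTest φ) :
    ∫ x, (∫ y in Iic x, v y) * deriv φ x = -∫ x, v x * φ x := by
  let F : ℝ → ℝ → ℝ := fun x y =>
    {q : ℝ × ℝ | q.2 ≤ q.1}.indicator (fun q => deriv φ q.1 * v q.2) (x, y)
  have hF : Integrable (Function.uncurry F) (volume.prod volume) :=
    ((isTest_deriv hφ).integrable.mul_prod hv).indicator (measurableSet_le measurable_snd measurable_fst)
  have hswap := integral_integral_swap hF
  have h1 : ∀ x, ∫ y, F x y = (∫ y in Iic x, v y) * deriv φ x := by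
    intro x
    have : F x = (Iic x).indicator (fun y => deriv φ x * v y) := by
      funext y
      by_cases h : y ≤ x <;> simp [F, indicator, h]
    rw [this, integral_indicator measurableSet_Iic, integral_const_mul, mul_comm]
  have h2 : ∀ y, ∫ x, F x y = -(v y * φ y) := by
    intro y
    have : (fun x => F x y) = (Ici y).indicator (fun x => deriv φ x * v y) := by
      funext x
      by_cases h : y ≤ x <;> simp [F, indicator, h]
    rw [this, integral_indicator measurableSet_Ici, integral_mul_const, integral_Ici_eq_integral_Ioi,
      HasCompactSupport.integral_Ioi_deriv_eq (hφ.1.of_le (by exact_mod_cast le_top)) hφ.2]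
    ring
  simp only [h1, h2] at hswap
  rw [hswap, integral_neg]

/-- The primitive from `-∞` vanishes to the left of the support, and the zero mean makes it vanish
to the right as well. -/
theorem IsTest.exists_deriv_eq {η : ℝ → ℝ} (hη : IsTest η) (h0 : ∫ x, η x = 0) :
    ∃ φ, IsTest φ ∧ deriv φ = η := by
  have hd := hasDerivAt_integral_Iic hη.1.continuous fun x => hη.integrable.integrableOn
  have hderiv : deriv (fun x => ∫ y in Iic x, η y) = η := funext fun x => (hd x).deriv
  refine ⟨fun x => ∫ y in Iic x, η y, ⟨?_, ?_⟩, hderiv⟩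
  · rw [contDiff_infty_iff_deriv, hderiv]
    exact ⟨fun x => (hd x).differentiableAt, hη.1⟩
  · obtain ⟨r, hr⟩ := hη.2.isCompact.isBounded.subset_closedBall 0
    have hz : ∀ y, r < |y| → η y = 0 := by
      intro y hy
      by_contra h
      have := hr (subset_tsupport _ h)
      rw [mem_closedBall_zero_iff, Real.norm_eq_abs] at this
      linarith
    refine HasCompactSupport.intro (isCompact_Icc (a := -r) (b := r)) fun x hx => ?_
    rw [mem_Icc, not_and_or, not_le, not_le] at hx
    rcases hx with hx | hx
    · refine setIntegral_eq_zero_of_forall_eq_zero fun y hy => hz y ?_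
      have : y ≤ x := hy
      rw [lt_abs]
      right
      linarith
    · have hc : ∫ y in (Iic x)ᶜ, η y = 0 := by
        refine setIntegral_eq_zero_of_forall_eq_zero fun y hy => hz y ?_
        have : x < y := by simpa using hy
        rw [lt_abs]
        left
        linarith
      have := integral_add_compl (μ := volume) (measurableSet_Iic (a := x)) hη.integrable
      rw [hc, h0, add_zero] at this
      exact this

/-- The du Bois-Reymond lemma: subtracting from a test function its mean times a fixed bump of
integral one leaves the derivative of a test function. -/
theorem ae_eq_const_of_forall_integral_mul_deriv_eq_zero {u : ℝ → ℝ} (hu : LocallyIntegrable u)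
    (h : ∀ φ, IsTest φ → ∫ x, u x * deriv φ x = 0) : ∃ c, u =ᵐ[volume] fun _ => c := by
  let B : ContDiffBump (0 : ℝ) := default
  have hB : IsTest (B.normed volume) := ⟨B.contDiff_normed, B.hasCompactSupport_normed⟩
  have hB1 : ∫ x, B.normed volume x = 1 := B.integral_normed
  have hmul : ∀ ψ, IsTest ψ → Integrable fun x => u x * ψ x := fun ψ hψ => by
    simpa [mul_comm] using hu.integrable_smul_left_of_hasCompactSupport hψ.1.continuous hψ.2
  refine ⟨∫ x, u x * B.normed volume x, ae_eq_of_integral_contDiff_smul_eq hu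
    (locallyIntegrable_const _) fun ψ hψ1 hψ2 => ?_⟩
  have hψ : IsTest ψ := ⟨hψ1, hψ2⟩
  set I := ∫ x, ψ x with hI
  have hη : IsTest fun x => ψ x - I * B.normed volume x :=
    ⟨hψ1.sub (contDiff_const.mul hB.1), hψ2.sub hB.2.mul_left⟩
  obtain ⟨φ, hφ, hφη⟩ := hη.exists_deriv_eq (by
    rw [integral_sub hψ.integrable (hB.integrable.const_mul _), integral_const_mul, hB1]
    simp [hI])
  have h1 := h φ hφ
  rw [hφη] at h1
  have h2 : ∀ x, u x * (ψ x - I * B.normed volume x)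
      = u x * ψ x - I * (u x * B.normed volume x) := fun x => by ring
  simp only [h2] at h1
  rw [integral_sub (hmul _ hψ) ((hmul _ hB).const_mul _), integral_const_mul] at h1
  simp only [smul_eq_mul]
  rw [integral_mul_const, ← hI]
  simp only [mul_comm (ψ _)]
  linarith

theorem HasWeakDeriv.exists_ae_eq {w v : ℝ → ℝ} (h : HasWeakDeriv w v) (hv : Integrable v) :
    ∃ c, w =ᵐ[volume] fun x => c + ∫ y in Iic x, v y := by
  obtain ⟨hw, -, hwv⟩ := h
  have hc := continuous_integral_Iic hv
  obtain ⟨c, hc⟩ := ae_eq_const_of_forall_integral_mul_deriv_eq_zero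
    (hw.sub hc.locallyIntegrable) fun φ hφ => by
      have h1 : Integrable fun x => w x * deriv φ x := by
        simpa [mul_comm] using
          hw.integrable_smul_left_of_hasCompactSupport (isTest_deriv hφ).1.continuous (isTest_deriv hφ).2
      have h2 : Integrable fun x => (∫ y in Iic x, v y) * deriv φ x := by
        simpa [mul_comm] using hc.locallyIntegrable.integrable_smul_left_of_hasCompactSupport
          (isTest_deriv hφ).1.continuous (isTest_deriv hφ).2
      simp only [Pi.sub_apply, sub_mul]
      rw [integral_sub h1 h2, hwv φ hφ, integral_primitive_mul_deriv hv hφ, sub_self]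
  refine ⟨c, hc.mono fun x hx => ?_⟩
  simp only [Pi.sub_apply] at hx
  linarith

/-- A function whose weak derivative is integrable has a continuous representative. -/
theorem HasWeakDeriv.exists_continuous_ae_eq {w v : ℝ → ℝ} (h : HasWeakDeriv w v)
    (hv : Integrable v) : ∃ w' : ℝ → ℝ, Continuous w' ∧ w =ᵐ[volume] w' := by
  obtain ⟨c, hc⟩ := h.exists_ae_eq hv
  exact ⟨_, continuous_const.add (continuous_integral_Iic hv), hc⟩

/-- A continuous function with a continuous integrable weak derivative is differentiable. -/
theorem HasWeakDeriv.hasDerivAt {w v v' : ℝ → ℝ} (h : HasWeakDeriv w v) (hv : Integrable v)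
    (hw : Continuous w) (hv' : Continuous v') (hvv' : v =ᵐ[volume] v') (x : ℝ) :
    HasDerivAt w (v' x) x := by
  obtain ⟨c, hc⟩ := h.exists_ae_eq hv
  have hvi := hv.congr hvv'
  have hw' : w = fun x => c + ∫ y in Iic x, v' y := by
    refine (Continuous.ae_eq_iff_eq volume hw
      (continuous_const.add (continuous_integral_Iic hvi))).1 ?_
    refine hc.trans (Eventually.of_forall fun x => ?_)
    simp only
    congr 1
    exact integral_congr_ae (ae_restrict_of_ae hvv')
  rw [hw']
  exact (hasDerivAt_integral_Iic hv' (fun x => hvi.integrableOn) x).const_add c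

/-! ### Integral equations of Volterra type on the line -/

/-- `∫_{-∞}^x e^{w (x - y)} v(y) dy`. -/
def expInt (w : ℂ) (v : ℝ → ℂ) (x : ℝ) : ℂ :=
  ∫ y in Iic x, Complex.exp (w * ((x - y : ℝ) : ℂ)) * v y

theorem norm_exp_mul_le_one {w : ℂ} (hw : w.re ≤ 0) {t : ℝ} (ht : 0 ≤ t) :
    ‖Complex.exp (w * (t : ℂ))‖ ≤ 1 := by
  rw [Complex.norm_exp, Real.exp_le_one_iff, Complex.re_mul_ofReal]
  exact mul_nonpos_of_nonpos_of_nonneg hw ht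

theorem norm_exp_mul_le_norm {w : ℂ} (hw : w.re ≤ 0) {x y : ℝ} (h : y ≤ x) (a : ℂ) :
    ‖Complex.exp (w * ((x - y : ℝ) : ℂ)) * a‖ ≤ ‖a‖ := by
  rw [norm_mul]
  exact mul_le_of_le_one_left (norm_nonneg _) (norm_exp_mul_le_one hw (sub_nonneg.2 h))

theorem integrableOn_exp_mul {w : ℂ} (hw : w.re ≤ 0) {v : ℝ → ℂ} (hv : Integrable v) (x : ℝ) :
    IntegrableOn (fun y => Complex.exp (w * ((x - y : ℝ) : ℂ)) * v y) (Iic x) := by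
  refine Integrable.mono hv.integrableOn ?_ ?_
  · exact (Continuous.aestronglyMeasurable (by fun_prop)).mul hv.aestronglyMeasurable.restrict
  · exact ae_restrict_of_forall_mem measurableSet_Iic fun y hy => norm_exp_mul_le_norm hw hy _

theorem norm_expInt_le {w : ℂ} (hw : w.re ≤ 0) {v : ℝ → ℂ} {ψ : ℝ → ℝ} {x : ℝ}
    (hψ : IntegrableOn ψ (Iic x)) (h : ∀ y, ‖v y‖ ≤ ψ y) : ‖expInt w v x‖ ≤ ∫ y in Iic x, ψ y :=
  norm_integral_le_of_norm_le hψ <| ae_restrict_of_forall_mem measurableSet_Iic fun y hy =>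
    (norm_exp_mul_le_norm hw hy _).trans (h y)

theorem tendsto_expInt_atBot {w : ℂ} (hw : w.re ≤ 0) {v : ℝ → ℂ} (hv : Integrable v) :
    Tendsto (expInt w v) atBot (𝓝 0) :=
  squeeze_zero_norm (fun _ => norm_expInt_le hw hv.norm.integrableOn fun _ => le_rfl)
    (tendsto_integral_Iic_zero tendsto_id)

/-- Writing the kernel as `e^{wx} e^{-wy}` leaves the product rule. The factor `e^{-wy}` may grow at
`+∞`, so only integrability on the half-lines `Iic x` is available. -/
theorem hasDerivAt_expInt {w : ℂ} (hw : w.re ≤ 0) {v : ℝ → ℂ} (hc : Continuous v)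
    (hv : Integrable v) (x : ℝ) : HasDerivAt (expInt w v) (w * expInt w v x + v x) x := by
  have h1 : ∀ x y : ℝ, Complex.exp (-(w * (y : ℂ))) * v y
      = Complex.exp (-(w * (x : ℂ))) * (Complex.exp (w * ((x - y : ℝ) : ℂ)) * v y) := by
    intro x y
    rw [← mul_assoc, ← Complex.exp_add]
    congr 2
    push_cast
    ring
  have hi : ∀ x, IntegrableOn (fun y : ℝ => Complex.exp (-(w * (y : ℂ))) * v y) (Iic x) := by
    intro x
    simp_rw [h1 x]
    exact (integrableOn_exp_mul hw hv x).const_mul _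
  have h2 : expInt w v = fun x : ℝ =>
      Complex.exp (w * (x : ℂ)) * ∫ y in Iic x, Complex.exp (-(w * (y : ℂ))) * v y := by
    funext x
    simp_rw [h1 x]
    rw [integral_const_mul, ← mul_assoc, ← Complex.exp_add, add_neg_cancel, Complex.exp_zero,
      one_mul]
    rfl
  have hd := hasDerivAt_integral_Iic (by fun_prop) hi x
  have he : HasDerivAt (fun x : ℝ => Complex.exp (w * (x : ℂ))) (Complex.exp (w * (x : ℂ)) * w) x := by
    simpa using ((Complex.ofRealCLM.hasDerivAt (x := x)).const_mul w).cexp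
  have hm := he.mul hd
  rw [h2]
  refine hm.congr_deriv ?_
  have : Complex.exp (w * (x : ℂ)) * (Complex.exp (-(w * (x : ℂ))) * v x) = v x := by
    rw [← mul_assoc, ← Complex.exp_add, add_neg_cancel, Complex.exp_zero, one_mul]
  rw [this]
  ring

theorem continuous_expInt {w : ℂ} (hw : w.re ≤ 0) {v : ℝ → ℂ} (hc : Continuous v)
    (hv : Integrable v) : Continuous (expInt w v) :=
  continuous_iff_continuousAt.2 fun x => (hasDerivAt_expInt hw hc hv x).continuousAt

theorem expInt_sub {w : ℂ} (hw : w.re ≤ 0) {v v' : ℝ → ℂ} (hv : Integrable v)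
    (hv' : Integrable v') (x : ℝ) :
    expInt w v x - expInt w v' x = expInt w (fun y => v y - v' y) x := by
  simp only [expInt, mul_sub]
  rw [integral_sub (integrableOn_exp_mul hw hv x) (integrableOn_exp_mul hw hv' x)]

theorem expInt_zero_left (v : ℝ → ℂ) (x : ℝ) : expInt 0 v x = ∫ y in Iic x, v y := by
  simp [expInt]

/-! ### Existence by contraction in an exponentially weighted supremum norm. -/

section Existence

open BoundedContinuousFunction

variable {q : ℝ → ℝ}

theorem integral_Iic_nonneg (h0 : ∀ x, 0 ≤ q x) (x : ℝ) : 0 ≤ ∫ y in Iic x, q y :=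
  integral_nonneg h0

theorem integral_Iic_le_integral (hi : Integrable q) (h0 : ∀ x, 0 ≤ q x) (x : ℝ) :
    ∫ y in Iic x, q y ≤ ∫ y, q y :=
  setIntegral_le_integral hi (Eventually.of_forall h0)

theorem integrable_mul_exp (hi : Integrable q) (h0 : ∀ x, 0 ≤ q x) :
    Integrable fun x => q x * Real.exp (2 * ∫ y in Iic x, q y) := by
  refine hi.mul_bdd (c := Real.exp (2 * ∫ y, q y)) ?_ (Eventually.of_forall fun x => ?_)
  · have := continuous_integral_Iic hi
    exact Continuous.aestronglyMeasurable (by fun_prop)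
  · rw [Real.norm_eq_abs, Real.abs_exp, Real.exp_le_exp]
    linarith [integral_Iic_le_integral hi h0 x]

/-- With `A(x) = ∫_{-∞}^x q`, a primitive of `q e^{2A}` is `e^{2A} / 2`. The factor 2 in the weight
is what produces the contraction constant `1 / 2`, however large `∫ q` is. -/
theorem integral_Iic_mul_exp (hc : Continuous q) (hi : Integrable q) (h0 : ∀ x, 0 ≤ q x) (x : ℝ) :
    ∫ y in Iic x, q y * Real.exp (2 * ∫ z in Iic y, q z)
      = (Real.exp (2 * ∫ z in Iic x, q z) - 1) / 2 := by
  have hd : ∀ y, HasDerivAt (fun y => Real.exp (2 * ∫ z in Iic y, q z) / 2)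
      (q y * Real.exp (2 * ∫ z in Iic y, q z)) y := by
    intro y
    have := (((hasDerivAt_integral_Iic hc (fun x => hi.integrableOn) y).const_mul 2).exp).div_const 2
    refine this.congr_deriv ?_
    ring
  have ht : Tendsto (fun y => Real.exp (2 * ∫ z in Iic y, q z) / 2) atBot (𝓝 (1 / 2)) := by
    have h1 : Tendsto (fun y => ∫ z in Iic y, q z) atBot (𝓝 0) :=
      tendsto_integral_Iic_zero tendsto_id
    have := ((h1.const_mul 2).rexp).div_const 2
    simpa using this
  rw [integral_Iic_of_hasDerivAt_of_tendsto' (fun y _ => hd y)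
    (integrable_mul_exp hi h0).integrableOn ht]
  ring

/-- The right-hand side of one row of the integral equation, conjugated by the weight
`e^{2 ∫_{-∞}^x q}`. -/
def weightedRow (q : ℝ → ℝ) (w : ℂ) (α β : ℝ → ℂ) (n : ℝ → ℂ × ℂ) (x : ℝ) : ℂ :=
  (Real.exp (-(2 * ∫ y in Iic x, q y)) : ℝ) *
    expInt w (fun y => α y * ((Real.exp (2 * ∫ z in Iic y, q z) : ℝ) * (n y).1) +
      β y * ((Real.exp (2 * ∫ z in Iic y, q z) : ℝ) * (n y).2)) x

variable {w : ℂ} {α β : ℝ → ℂ}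

theorem norm_row_le (hαβ : ∀ x, ‖α x‖ + ‖β x‖ ≤ q x) (c : ℝ) {a : ℂ × ℂ} {B : ℝ} (ha : ‖a‖ ≤ B)
    (y : ℝ) : ‖α y * ((Real.exp c : ℝ) * a.1) + β y * ((Real.exp c : ℝ) * a.2)‖
      ≤ q y * Real.exp c * B := by
  have h1 : ‖a.1‖ ≤ B := (norm_fst_le a).trans ha
  have h2 : ‖a.2‖ ≤ B := (norm_snd_le a).trans ha
  have hB : 0 ≤ B := (norm_nonneg _).trans h1
  have he := Real.exp_pos c
  calc _ ≤ ‖α y‖ * (Real.exp c * ‖a.1‖) + ‖β y‖ * (Real.exp c * ‖a.2‖) := by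
        refine (norm_add_le _ _).trans (le_of_eq ?_)
        simp only [norm_mul, Complex.norm_real, Real.norm_eq_abs, Real.abs_exp]
    _ ≤ ‖α y‖ * (Real.exp c * B) + ‖β y‖ * (Real.exp c * B) := by gcongr
    _ = (‖α y‖ + ‖β y‖) * (Real.exp c * B) := by ring
    _ ≤ q y * (Real.exp c * B) := by gcongr; exact hαβ y
    _ = _ := by ring

theorem integrable_row (hi : Integrable q) (hα : Continuous α)
    (hβ : Continuous β) (hαβ : ∀ x, ‖α x‖ + ‖β x‖ ≤ q x) (n : ℝ →ᵇ ℂ × ℂ) :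
    (Continuous fun y => α y * ((Real.exp (2 * ∫ z in Iic y, q z) : ℝ) * (n y).1) +
      β y * ((Real.exp (2 * ∫ z in Iic y, q z) : ℝ) * (n y).2)) ∧
    Integrable fun y => α y * ((Real.exp (2 * ∫ z in Iic y, q z) : ℝ) * (n y).1) +
      β y * ((Real.exp (2 * ∫ z in Iic y, q z) : ℝ) * (n y).2) := by
  have h0 : ∀ x, 0 ≤ q x := fun x => (by positivity : (0 : ℝ) ≤ ‖α x‖ + ‖β x‖).trans (hαβ x)
  have hA := continuous_integral_Iic hi
  have hn := n.continuous
  have hcont : Continuous fun y => α y * ((Real.exp (2 * ∫ z in Iic y, q z) : ℝ) * (n y).1) +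
      β y * ((Real.exp (2 * ∫ z in Iic y, q z) : ℝ) * (n y).2) := by fun_prop
  exact ⟨hcont, ((integrable_mul_exp hi h0).mul_const ‖n‖).mono' hcont.aestronglyMeasurable
    (Eventually.of_forall fun y => norm_row_le hαβ _ (n.norm_coe_le_norm y) y)⟩

theorem continuous_weightedRow (hw : w.re ≤ 0) (hi : Integrable q)
    (hα : Continuous α) (hβ : Continuous β) (hαβ : ∀ x, ‖α x‖ + ‖β x‖ ≤ q x) (n : ℝ →ᵇ ℂ × ℂ) :
    Continuous (weightedRow q w α β n) := by
  obtain ⟨h1, h2⟩ := integrable_row hi hα hβ hαβ n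
  have hA := continuous_integral_Iic hi
  have := continuous_expInt hw h1 h2
  unfold weightedRow
  fun_prop

theorem norm_weightedRow_le (hw : w.re ≤ 0) (hc : Continuous q) (hi : Integrable q)
    (hαβ : ∀ x, ‖α x‖ + ‖β x‖ ≤ q x) {n : ℝ → ℂ × ℂ} {B : ℝ}
    (hn : ∀ y, ‖n y‖ ≤ B) (x : ℝ) : ‖weightedRow q w α β n x‖ ≤ B / 2 := by
  have h0 : ∀ x, 0 ≤ q x := fun x => (by positivity : (0 : ℝ) ≤ ‖α x‖ + ‖β x‖).trans (hαβ x)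
  have hB : 0 ≤ B := (norm_nonneg _).trans (hn 0)
  have h1 := norm_expInt_le hw ((integrable_mul_exp hi h0).mul_const B).integrableOn
    (fun y => norm_row_le hαβ (2 * ∫ z in Iic y, q z) (hn y) y) (x := x)
  rw [integral_mul_const, integral_Iic_mul_exp hc hi h0] at h1
  rw [weightedRow, norm_mul, Complex.norm_real, Real.norm_eq_abs, Real.abs_exp, Real.exp_neg]
  set e := Real.exp (2 * ∫ z in Iic x, q z) with he
  have hpos : 0 < e := Real.exp_pos _
  calc _ ≤ e⁻¹ * ((e - 1) / 2 * B) := by gcongr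
    _ = (1 - e⁻¹) * (B / 2) := by field_simp
    _ ≤ 1 * (B / 2) := by
        have : 0 < e⁻¹ := inv_pos.2 hpos
        gcongr
        linarith
    _ = B / 2 := one_mul _

theorem weightedRow_sub (hw : w.re ≤ 0) (hi : Integrable q)
    (hα : Continuous α) (hβ : Continuous β) (hαβ : ∀ x, ‖α x‖ + ‖β x‖ ≤ q x)
    (n n' : ℝ →ᵇ ℂ × ℂ) (x : ℝ) :
    weightedRow q w α β n x - weightedRow q w α β n' x
      = weightedRow q w α β (fun y => n y - n' y) x := by
  simp only [weightedRow]
  rw [← mul_sub, expInt_sub hw (integrable_row hi hα hβ hαβ n).2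
    (integrable_row hi hα hβ hαβ n').2]
  congr 2
  funext y
  simp only [Prod.fst_sub, Prod.snd_sub]
  ring

/-- Existence of a bounded continuous solution of a two-dimensional Volterra equation on the line
with integrable coefficients. -/
theorem exists_volterra_solution (hw : w.re ≤ 0) (hc : Continuous q) (hi : Integrable q)
    {γ δ : ℝ → ℂ} (hα : Continuous α) (hβ : Continuous β) (hγ : Continuous γ) (hδ : Continuous δ)
    (hαβ : ∀ x, ‖α x‖ + ‖β x‖ ≤ q x) (hγδ : ∀ x, ‖γ x‖ + ‖δ x‖ ≤ q x) :
    ∃ p r : ℝ → ℂ, Continuous p ∧ Continuous r ∧ (∃ B, ∀ x, ‖p x‖ ≤ B ∧ ‖r x‖ ≤ B) ∧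
      (∀ x, p x = 1 + expInt 0 (fun y => α y * p y + β y * r y) x) ∧
      ∀ x, r x = expInt w (fun y => γ y * p y + δ y * r y) x := by
  have h0 : ∀ x, 0 ≤ q x := fun x => (by positivity : (0 : ℝ) ≤ ‖α x‖ + ‖β x‖).trans (hαβ x)
  have hA := continuous_integral_Iic hi
  have hw0 : (0 : ℂ).re ≤ 0 := le_rfl
  set A : ℝ → ℝ := fun x => ∫ y in Iic x, q y with hAdef
  -- The unknown is `n = e^{-2A} (p, r)`, so the inhomogeneous term `1` becomes `e^{-2A}`, which is
  -- at most one.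
  let T : (ℝ →ᵇ ℂ × ℂ) → (ℝ →ᵇ ℂ × ℂ) := fun n =>
    BoundedContinuousFunction.ofNormedAddCommGroup
      (fun x => ((Real.exp (-(2 * A x)) : ℝ) + weightedRow q 0 α β n x, weightedRow q w γ δ n x))
      (((by fun_prop : Continuous fun x => ((Real.exp (-(2 * A x)) : ℝ) : ℂ)).add
        (continuous_weightedRow hw0 hi hα hβ hαβ n)).prodMk
        (continuous_weightedRow hw hi hγ hδ hγδ n)) (1 + ‖n‖ / 2) (by
          intro x
          have h1 := norm_weightedRow_le hw0 hc hi hαβ n.norm_coe_le_norm x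
          have h2 := norm_weightedRow_le hw hc hi hγδ n.norm_coe_le_norm x
          have h3 : ‖((Real.exp (-(2 * A x)) : ℝ) : ℂ)‖ ≤ 1 := by
            rw [Complex.norm_real, Real.norm_eq_abs, Real.abs_exp, Real.exp_le_one_iff]
            linarith [integral_Iic_nonneg h0 x]
          refine norm_prod_le_iff.2 ⟨(norm_add_le _ _).trans (add_le_add h3 h1), ?_⟩
          exact h2.trans (by linarith))
  have hT : ContractingWith (1 / 2) T := by
    refine ⟨by rw [← NNReal.coe_lt_coe]; norm_num, LipschitzWith.of_dist_le_mul fun n n' => ?_⟩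
    have hnn : ∀ y, ‖n y - n' y‖ ≤ dist n n' := fun y => by
      rw [← dist_eq_norm]
      exact BoundedContinuousFunction.dist_coe_le_dist y
    refine (BoundedContinuousFunction.dist_le (by positivity)).2 fun x => ?_
    have h1 := norm_weightedRow_le hw0 hc hi hαβ hnn x
    have h2 := norm_weightedRow_le hw hc hi hγδ hnn x
    rw [← weightedRow_sub hw0 hi hα hβ hαβ] at h1
    rw [← weightedRow_sub hw hi hγ hδ hγδ] at h2
    have e : (((1 / 2 : NNReal) : ℝ)) * dist n n' = dist n n' / 2 := by
      push_cast
      ring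
    rw [e]
    simp only [T, BoundedContinuousFunction.coe_ofNormedAddCommGroup, Prod.dist_eq]
    refine max_le ?_ ?_
    · simpa [dist_eq_norm] using h1
    · simpa [dist_eq_norm] using h2
  set n := hT.fixedPoint T with hn
  have hfix : T n = n := hT.fixedPoint_isFixedPt
  have hexp : ∀ x, ((Real.exp (2 * A x) : ℝ) : ℂ) * (Real.exp (-(2 * A x)) : ℝ) = 1 := fun x => by
    rw [← Complex.ofReal_mul, ← Real.exp_add, add_neg_cancel, Real.exp_zero, Complex.ofReal_one]
  have hbd : ∀ x a, ‖a‖ ≤ ‖n‖ →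
      ‖((Real.exp (2 * A x) : ℝ) : ℂ) * a‖ ≤ Real.exp (2 * ∫ y, q y) * ‖n‖ := by
    intro x a ha
    rw [norm_mul, Complex.norm_real, Real.norm_eq_abs, Real.abs_exp]
    have := integral_Iic_le_integral hi h0 x
    gcongr
  refine ⟨fun x => (Real.exp (2 * A x) : ℝ) * (n x).1, fun x => (Real.exp (2 * A x) : ℝ) * (n x).2,
    by fun_prop, by fun_prop, ⟨Real.exp (2 * ∫ y, q y) * ‖n‖, fun x =>
      ⟨hbd x _ ((norm_fst_le _).trans (n.norm_coe_le_norm x)),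
        hbd x _ ((norm_snd_le _).trans (n.norm_coe_le_norm x))⟩⟩, fun x => ?_, fun x => ?_⟩
  · have h := congrArg Prod.fst (DFunLike.congr_fun hfix x)
    have h' : (n x).1 = (Real.exp (-(2 * A x)) : ℝ) + weightedRow q 0 α β n x := h.symm
    simp only
    rw [h', weightedRow, mul_add, ← mul_assoc, hexp, one_mul]
  · have h := congrArg Prod.snd (DFunLike.congr_fun hfix x)
    have h' : (n x).2 = weightedRow q w γ δ n x := h.symm
    simp only
    rw [h', weightedRow, ← mul_assoc, hexp, one_mul]

end Existence

/-! ### Asymptotics of the rotated system -/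

/-- A solution that vanishes at `-∞` of `y' = w y + e`, `Re w ≤ 0`, is bounded by the `L¹` norm
of the forcing term. -/
theorem norm_le_integral_of_hasDerivAt {w : ℂ} (hw : w.re ≤ 0) {y e : ℝ → ℂ} {ψ : ℝ → ℝ}
    (hψc : Continuous ψ) (hψ : Integrable ψ) (he : ∀ t, ‖e t‖ ≤ ψ t)
    (hy : ∀ t, HasDerivAt y (w * y t + e t) t) (h0 : Tendsto y atBot (𝓝 0)) (x : ℝ) :
    ‖y x‖ ≤ ∫ t, ψ t := by
  have hψ0 : ∀ t, 0 ≤ ψ t := fun t => (norm_nonneg _).trans (he t)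
  have key : ∀ a ≤ x, ‖y x‖ ≤ ‖y a‖ + ∫ t, ψ t := by
    intro a ha
    have hexp : ∀ t : ℝ, HasDerivAt (fun t : ℝ => Complex.exp (w * ((x - t : ℝ) : ℂ)))
        (Complex.exp (w * ((x - t : ℝ) : ℂ)) * (-w)) t := by
      intro t
      have h1 : HasDerivAt (fun t : ℝ => w * ((x - t : ℝ) : ℂ)) (-w) t := by
        have := (((hasDerivAt_id t).const_sub x).ofReal_comp).const_mul w
        simpa using this
      exact h1.cexp
    -- The integrating factor `e^{w(x - t)}` has modulus at most one for `t ≤ x` and equals one at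
    -- `t = x`; the initial time `a` is later sent to `-∞`.
    have hg : ∀ t, HasDerivAt (fun t => Complex.exp (w * ((x - t : ℝ) : ℂ)) * y t)
        (Complex.exp (w * ((x - t : ℝ) : ℂ)) * e t) t := by
      intro t
      refine ((hexp t).mul (hy t)).congr_deriv ?_
      ring
    have hB : ∀ t, HasDerivAt (fun t => ‖y a‖ + ((∫ s in Iic t, ψ s) - ∫ s in Iic a, ψ s)) (ψ t) t :=
      fun t => ((hasDerivAt_integral_Iic hψc (fun x => hψ.integrableOn) t).sub_const _).const_add _
    have := image_norm_le_of_norm_deriv_right_le_deriv_boundary (a := a) (b := x)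
      (fun t _ => (hg t).continuousAt.continuousWithinAt)
      (fun t _ => (hg t).hasDerivWithinAt) (B := fun t => ‖y a‖ +
        ((∫ s in Iic t, ψ s) - ∫ s in Iic a, ψ s)) (B' := ψ) ?_ hB
      (fun t ht => (norm_exp_mul_le_norm hw ht.2.le _).trans (he t)) (x := x) ⟨ha, le_rfl⟩
    · rw [sub_self, Complex.ofReal_zero, mul_zero, Complex.exp_zero, one_mul] at this
      have h1 := integral_Iic_nonneg hψ0 a
      have h2 := integral_Iic_le_integral hψ hψ0 x
      linarith
    · simpa using norm_exp_mul_le_norm hw ha (y a)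
  have hlim : Tendsto (fun a => ‖y a‖ + ∫ t, ψ t) atBot (𝓝 (0 + ∫ t, ψ t)) := by
    simpa using h0.norm.add_const (∫ t, ψ t)
  rw [zero_add] at hlim
  exact ge_of_tendsto hlim ((eventually_le_atBot x).mono key)

/-- The scattering problem in the frame that rotates with `f / 2`. -/
structure IsRotatedSystem (q s b : ℝ → ℝ) (ν w C : ℂ) (P R : ℝ → ℂ) : Prop where
  hasDerivAt_fst : ∀ x, HasDerivAt P (-ν * q x * P x + (-ν * s x + b x) * R x) x
  hasDerivAt_snd : ∀ x, HasDerivAt R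
    (w * R x + ν * q x * R x + (-ν * s x - b x) * P x) x
  tendsto_fst : Tendsto P atBot (𝓝 C)
  tendsto_snd : Tendsto R atBot (𝓝 0)

namespace IsRotatedSystem

variable {q s b : ℝ → ℝ} {ν w C : ℂ} {P R : ℝ → ℂ}

/-- The `b` terms cancel because `b` is real and enters antisymmetrically, and `w` contributes `Re w
|R|² ≤ 0`. The resulting growth rate involves neither `b` nor `w`. -/
theorem deriv_energy_le {q s b : ℝ} {ν w P R : ℂ} (hν : ‖ν‖ ≤ 1) (hw : w.re ≤ 0) :
    2 * inner ℝ P (-ν * q * P + (-ν * s + b) * R) +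
      2 * inner ℝ R (w * R + ν * q * R + (-ν * s - b) * P)
      ≤ 2 * (|q| + |s|) * (‖P‖ ^ 2 + ‖R‖ ^ 2) := by
  have e : inner ℝ P (-ν * q * P + (-ν * s + b) * R) +
      inner ℝ R (w * R + ν * q * R + (-ν * s - b) * P)
      = w.re * ‖R‖ ^ 2 + ((inner ℝ P (-ν * q * P) + inner ℝ R (ν * q * R)) +
        (inner ℝ P (-ν * s * R) + inner ℝ R (-ν * s * P))) := by
    rw [Complex.sq_norm, Complex.normSq_apply]
    simp only [Complex.inner, Complex.add_re, Complex.add_im, Complex.sub_re, Complex.sub_im,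
      Complex.mul_re, Complex.mul_im, Complex.neg_re, Complex.neg_im, Complex.ofReal_re,
      Complex.ofReal_im, Complex.conj_re, Complex.conj_im]
    ring
  have hb : ∀ (a : ℝ) (c : ℂ), ‖c‖ ≤ 1 → ∀ X Y : ℂ,
      inner ℝ X (c * a * Y) ≤ |a| * (‖X‖ * ‖Y‖) := by
    intro a c hc X Y
    refine (real_inner_le_norm _ _).trans ?_
    rw [norm_mul, norm_mul, Complex.norm_real, Real.norm_eq_abs]
    calc ‖X‖ * (‖c‖ * |a| * ‖Y‖) ≤ ‖X‖ * (1 * |a| * ‖Y‖) := by gcongr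
      _ = _ := by ring
  have hν' : ‖-ν‖ ≤ 1 := by rwa [norm_neg]
  have h1 := hb q _ hν' P P
  have h2 := hb q _ hν R R
  have h3 := hb s _ hν' P R
  have h4 := hb s _ hν' R P
  have h5 : |s| * (2 * (‖P‖ * ‖R‖)) ≤ |s| * (‖P‖ ^ 2 + ‖R‖ ^ 2) :=
    mul_le_mul_of_nonneg_left (by nlinarith [sq_nonneg (‖P‖ - ‖R‖)]) (abs_nonneg _)
  have h6 : w.re * ‖R‖ ^ 2 ≤ 0 := mul_nonpos_of_nonpos_of_nonneg hw (sq_nonneg _)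
  have h7 : 0 ≤ |s| * (‖P‖ ^ 2 + ‖R‖ ^ 2) := by positivity
  have h8 : 0 ≤ |q| * (‖P‖ ^ 2 + ‖R‖ ^ 2) := by positivity
  nlinarith

/-- Uniform bound for the solutions of the rotated system. -/
theorem norm_sq_add_norm_sq_le (h : IsRotatedSystem q s b ν w C P R) (hq : Continuous q)
    (hs : Continuous s) (hqi : Integrable q) (hsi : Integrable s) (hν : ‖ν‖ ≤ 1) (hw : w.re ≤ 0)
    (x : ℝ) : ‖P x‖ ^ 2 + ‖R x‖ ^ 2 ≤ ‖C‖ ^ 2 * Real.exp (2 * ∫ y, (|q y| + |s y|)) := by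
  set k : ℝ → ℝ := fun y => |q y| + |s y| with hk
  have hkc : Continuous k := hq.abs.add hs.abs
  have hki : Integrable k := hqi.abs.add hsi.abs
  have hk0 : ∀ y, 0 ≤ k y := fun y => by positivity
  -- Grönwall's argument: the energy times the decaying weight is nonincreasing, with limit `‖C‖²`
  -- at `-∞`.
  set V : ℝ → ℝ := fun y => (‖P y‖ ^ 2 + ‖R y‖ ^ 2) * Real.exp (-(2 * ∫ t in Iic y, k t)) with hV
  have hd : ∀ y, HasDerivAt V ((2 * inner ℝ (P y) (-ν * q y * P y + (-ν * s y + b y) * R y) +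
      2 * inner ℝ (R y) (w * R y + ν * q y * R y + (-ν * s y - b y) * P y)) *
        Real.exp (-(2 * ∫ t in Iic y, k t)) + (‖P y‖ ^ 2 + ‖R y‖ ^ 2) *
        (Real.exp (-(2 * ∫ t in Iic y, k t)) * (-(2 * k y)))) y := fun y =>
    ((h.hasDerivAt_fst y).norm_sq.add (h.hasDerivAt_snd y).norm_sq).mul
      (((hasDerivAt_integral_Iic hkc (fun x => hki.integrableOn) y).const_mul 2).neg.exp)
  have hanti : Antitone V := antitone_of_hasDerivAt_nonpos hd fun y => by
    have h1 := deriv_energy_le (q := q y) (s := s y) (b := b y) (P := P y) (R := R y) hν hw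
    have h2 := Real.exp_pos (-(2 * ∫ t in Iic y, k t))
    have h3 := mul_le_mul_of_nonneg_right h1 h2.le
    simp only [Pi.zero_apply, hk] at *
    linarith
  have hlim : Tendsto V atBot (𝓝 (‖C‖ ^ 2)) := by
    have h1 : Tendsto (fun y => ∫ t in Iic y, k t) atBot (𝓝 0) :=
      tendsto_integral_Iic_zero tendsto_id
    have := ((h.tendsto_fst.norm.pow 2).add (h.tendsto_snd.norm.pow 2)).mul
      (h1.const_mul 2).neg.rexp
    simpa using this
  have h1 : V x ≤ ‖C‖ ^ 2 :=
    ge_of_tendsto hlim ((eventually_le_atBot x).mono fun y hy => hanti hy)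
  have h2 := integral_Iic_le_integral hki hk0 x
  have h3 : ‖P x‖ ^ 2 + ‖R x‖ ^ 2 = V x * Real.exp (2 * ∫ t in Iic x, k t) := by
    simp only [hV]
    rw [mul_assoc, ← Real.exp_add, neg_add_cancel, Real.exp_zero, mul_one]
  rw [h3]
  gcongr

/-- The equation for `P` does not contain `w`, so `P'` stays controlled as `w → ∞`. This permits the
integration by parts that puts the derivative on `P`. -/
theorem norm_deriv_fst_le {q s b : ℝ} {ν P R : ℂ} (hν : ‖ν‖ ≤ 1) {K : ℝ} (hP : ‖P‖ ≤ K)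
    (hR : ‖R‖ ≤ K) : ‖-ν * q * P + (-ν * s + b) * R‖ ≤ K * (|q| + |s| + |b|) := by
  have hK : 0 ≤ K := (norm_nonneg _).trans hP
  calc _ ≤ ‖ν‖ * |q| * ‖P‖ + (‖ν‖ * |s| + |b|) * ‖R‖ := by
        refine (norm_add_le _ _).trans ?_
        rw [norm_mul, norm_mul, norm_neg, Complex.norm_real, Real.norm_eq_abs, norm_mul]
        gcongr
        refine (norm_add_le _ _).trans ?_
        rw [norm_mul, norm_neg, Complex.norm_real, Real.norm_eq_abs, Complex.norm_real,
          Real.norm_eq_abs]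
    _ ≤ 1 * |q| * K + (1 * |s| + |b|) * K := by gcongr
    _ = _ := by ring

/-- The second component is small if `ν` is small and `w` is large: the forcing term `b P`
oscillates against `e^{w x}`. -/
theorem norm_snd_le (h : IsRotatedSystem q s b ν w C P R) (hq : Continuous q)
    (hs : Continuous s) (hb : Continuous b) (hqi : Integrable q) (hsi : Integrable s)
    (hbi : Integrable b) (hν : ‖ν‖ ≤ 1) (hw : w.re ≤ 0) (hw0 : w ≠ 0) {K : ℝ}
    (hP : ∀ x, ‖P x‖ ≤ K) (hR : ∀ x, ‖R x‖ ≤ K) {β : ℝ → ℝ} (hβ : ContDiff ℝ 1 β)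
    (hβs : HasCompactSupport β) {M : ℝ} (hM : ∀ x, |β x| ≤ M) (x : ℝ) :
    ‖R x‖ ≤ K * ((∫ y, |b y - β y|) + ‖ν‖ * (∫ y, (|q y| + |s y|)) +
      ‖w⁻¹‖ * ((∫ y, |deriv β y|) + M * ∫ y, (|q y| + |s y| + |b y|))) + ‖w⁻¹‖ * M * K := by
  have hK : 0 ≤ K := (norm_nonneg _).trans (hP 0)
  have hM0 : 0 ≤ M := (abs_nonneg _).trans (hM 0)
  have hβd : ∀ t, HasDerivAt β (deriv β t) t := fun t =>
    (hβ.differentiable one_ne_zero t).hasDerivAt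
  have hβ'c : Continuous (deriv β) := hβ.continuous_deriv le_rfl
  have hβ'i : Integrable (deriv β) := hβ'c.integrable_of_hasCompactSupport hβs.deriv
  have hβi : Integrable β := hβ.continuous.integrable_of_hasCompactSupport hβs
  have hβc := hβ.continuous
  have i1 : Integrable fun y => |b y - β y| := (hbi.sub hβi).abs
  have i2 : Integrable fun y => |q y| + |s y| := hqi.abs.add hsi.abs
  have i3 : Integrable fun y => |q y| + |s y| + |b y| := i2.add hbi.abs
  set ψ : ℝ → ℝ := fun y => K * (|b y - β y| + ‖ν‖ * (|q y| + |s y|) +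
    ‖w⁻¹‖ * (|deriv β y| + M * (|q y| + |s y| + |b y|))) with hψ
  have hψc : Continuous ψ := by fun_prop
  have j1 : Integrable fun y => ‖ν‖ * (|q y| + |s y|) := i2.const_mul ‖ν‖
  have j2 : Integrable fun y => ‖w⁻¹‖ * (|deriv β y| + M * (|q y| + |s y| + |b y|)) :=
    (hβ'i.abs.add (i3.const_mul M)).const_mul ‖w⁻¹‖
  have j3 : Integrable fun y => |b y - β y| + ‖ν‖ * (|q y| + |s y|) := i1.add j1
  have hψi : Integrable ψ := (j3.add j2).const_mul K
  have hint : ∫ y, ψ y = K * ((∫ y, |b y - β y|) + ‖ν‖ * (∫ y, (|q y| + |s y|)) +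
      ‖w⁻¹‖ * ((∫ y, |deriv β y|) + M * ∫ y, (|q y| + |s y| + |b y|))) := by
    simp only [hψ]
    rw [integral_const_mul, integral_add j3 j2, integral_add i1 j1, integral_const_mul,
      integral_const_mul, integral_add hβ'i.abs (i3.const_mul M), integral_const_mul]
  set P' : ℝ → ℂ := fun x => -ν * q x * P x + (-ν * s x + b x) * R x with hP'
  -- Subtracting `w⁻¹ β P` is the integration by parts in differential form: it replaces the forcing
  -- `-b P` by `(β - b) P`, which is small in `L¹`, plus terms carrying a factor `w⁻¹`.
  have hy : ∀ t, HasDerivAt (fun t => R t - w⁻¹ * (β t * P t))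
      (w * (R t - w⁻¹ * (β t * P t)) + (((β t - b t : ℝ) : ℂ) * P t + (ν * q t * R t + -ν * s t * P t)
        - w⁻¹ * ((deriv β t : ℝ) * P t + β t * P' t))) t := by
    intro t
    refine ((h.hasDerivAt_snd t).sub
      (((hβd t).ofReal_comp.mul (h.hasDerivAt_fst t)).const_mul w⁻¹)).congr_deriv ?_
    simp only [hP']
    push_cast
    field_simp
    ring
  have he : ∀ t, ‖((β t - b t : ℝ) : ℂ) * P t + (ν * q t * R t + -ν * s t * P t)
        - w⁻¹ * ((deriv β t : ℝ) * P t + β t * P' t)‖ ≤ ψ t := by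
    intro t
    have e1 : ‖((β t - b t : ℝ) : ℂ) * P t‖ ≤ |b t - β t| * K := by
      rw [norm_mul, Complex.norm_real, Real.norm_eq_abs, abs_sub_comm]
      gcongr
      exact hP t
    have e2 : ‖ν * q t * R t‖ ≤ ‖ν‖ * |q t| * K := by
      rw [norm_mul, norm_mul, Complex.norm_real, Real.norm_eq_abs]
      gcongr
      exact hR t
    have e3 : ‖-ν * s t * P t‖ ≤ ‖ν‖ * |s t| * K := by
      rw [norm_mul, norm_mul, norm_neg, Complex.norm_real, Real.norm_eq_abs]
      gcongr
      exact hP t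
    have e4 : ‖((deriv β t : ℝ) : ℂ) * P t‖ ≤ |deriv β t| * K := by
      rw [norm_mul, Complex.norm_real, Real.norm_eq_abs]
      gcongr
      exact hP t
    have e5 : ‖(β t : ℂ) * P' t‖ ≤ M * (K * (|q t| + |s t| + |b t|)) := by
      rw [norm_mul, Complex.norm_real, Real.norm_eq_abs]
      exact mul_le_mul (hM t) (norm_deriv_fst_le hν (hP t) (hR t)) (norm_nonneg _) hM0
    have e6 : ‖w⁻¹ * ((deriv β t : ℝ) * P t + β t * P' t)‖
        ≤ ‖w⁻¹‖ * (|deriv β t| * K + M * (K * (|q t| + |s t| + |b t|))) := by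
      rw [norm_mul]
      gcongr
      exact (norm_add_le _ _).trans (add_le_add e4 e5)
    calc _ ≤ |b t - β t| * K + (‖ν‖ * |q t| * K + ‖ν‖ * |s t| * K) +
          ‖w⁻¹‖ * (|deriv β t| * K + M * (K * (|q t| + |s t| + |b t|))) :=
          (norm_sub_le _ _).trans (add_le_add ((norm_add_le _ _).trans
            (add_le_add e1 ((norm_add_le _ _).trans (add_le_add e2 e3)))) e6)
      _ = ψ t := by
          simp only [hψ]
          ring
  have h0 : Tendsto (fun t => R t - w⁻¹ * (β t * P t)) atBot (𝓝 0) := by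
    have hβ0 : Tendsto β atBot (𝓝 0) := by
      rw [hasCompactSupport_iff_eventuallyEq, Filter.coclosedCompact_eq_cocompact] at hβs
      exact (hβs.filter_mono atBot_le_cocompact).tendsto
    have h1 : Tendsto (fun t => (β t : ℂ)) atBot (𝓝 0) := by
      have := (Complex.continuous_ofReal.tendsto 0).comp hβ0
      rwa [Complex.ofReal_zero] at this
    have := h.tendsto_snd.sub ((h1.mul h.tendsto_fst).const_mul w⁻¹)
    simpa using this
  have hmain := norm_le_integral_of_hasDerivAt hw hψc hψi he hy h0 x
  rw [hint] at hmain
  have hlast : ‖w⁻¹ * (β x * P x)‖ ≤ ‖w⁻¹‖ * M * K := by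
    rw [norm_mul, norm_mul, Complex.norm_real, Real.norm_eq_abs, mul_assoc]
    gcongr
    · exact hM x
    · exact hP x
  calc ‖R x‖ = ‖(R x - w⁻¹ * (β x * P x)) + w⁻¹ * (β x * P x)‖ := by rw [sub_add_cancel]
    _ ≤ _ := (norm_add_le _ _).trans (add_le_add hmain hlast)

/-- The equation for `P - C` has no damping (rate zero) and a forcing that is small in `L¹` once `ν`
and `R` are. -/
theorem norm_fst_sub_le (h : IsRotatedSystem q s b ν w C P R) (hq : Continuous q)
    (hs : Continuous s) (hb : Continuous b) (hqi : Integrable q) (hsi : Integrable s)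
    (hbi : Integrable b) {K ρ : ℝ}
    (hP : ∀ x, ‖P x‖ ≤ K) (hR : ∀ x, ‖R x‖ ≤ K) (hρ : ∀ x, ‖R x‖ ≤ ρ) (x : ℝ) :
    ‖P x - C‖ ≤ ‖ν‖ * K * (∫ y, (|q y| + |s y|)) + ρ * ∫ y, |b y| := by
  have i2 : Integrable fun y => ‖ν‖ * K * (|q y| + |s y|) := (hqi.abs.add hsi.abs).const_mul _
  have i3 : Integrable fun y => ρ * |b y| := hbi.abs.const_mul _
  rw [← integral_const_mul, ← integral_const_mul, ← integral_add i2 i3]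
  refine norm_le_integral_of_hasDerivAt (w := 0) (y := fun x => P x - C) le_rfl (by fun_prop)
    (i2.add i3) (e := fun x => -ν * q x * P x + (-ν * s x + b x) * R x) (fun t => ?_) (fun t => ?_)
    ?_ x
  · have e1 : ‖-ν * q t * P t‖ ≤ ‖ν‖ * |q t| * K := by
      rw [norm_mul, norm_mul, norm_neg, Complex.norm_real, Real.norm_eq_abs]
      gcongr
      exact hP t
    have e2 : ‖-ν * s t * R t‖ ≤ ‖ν‖ * |s t| * K := by
      rw [norm_mul, norm_mul, norm_neg, Complex.norm_real, Real.norm_eq_abs]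
      gcongr
      exact hR t
    have e3 : ‖(b t : ℂ) * R t‖ ≤ |b t| * ρ := by
      rw [norm_mul, Complex.norm_real, Real.norm_eq_abs]
      gcongr
      exact hρ t
    rw [add_mul]
    calc _ ≤ ‖ν‖ * |q t| * K + (‖ν‖ * |s t| * K + |b t| * ρ) :=
          (norm_add_le _ _).trans (add_le_add e1 ((norm_add_le _ _).trans (add_le_add e2 e3)))
      _ = ‖ν‖ * K * (|q t| + |s t|) + ρ * |b t| := by ring
  · simpa using (h.hasDerivAt_fst t).sub_const C
  · simpa using h.tendsto_fst.sub_const C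

/-- As `ν → 0` and `w → ∞`, the solution of the rotated system becomes constant. -/
theorem tendsto_const {ι : Type*} {l : Filter ι} {ν w : ι → ℂ} {P R : ι → ℝ → ℂ}
    (hq : Continuous q) (hs : Continuous s) (hb : Continuous b) (hqi : Integrable q)
    (hsi : Integrable s) (hbi : Integrable b) (hν : Tendsto ν l (𝓝 0))
    (hw : Tendsto (fun i => (w i)⁻¹) l (𝓝 0))
    (h : ∀ᶠ i in l, (w i).re ≤ 0 ∧ w i ≠ 0 ∧ IsRotatedSystem q s b (ν i) (w i) C (P i) (R i))
    (x : ℝ) : Tendsto (fun i => P i x) l (𝓝 C) ∧ Tendsto (fun i => R i x) l (𝓝 0) := by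
  -- The energy bound is independent of the index as soon as `‖ν‖ ≤ 1`, so one `K` serves
  -- eventually.
  set K : ℝ := √(‖C‖ ^ 2 * Real.exp (2 * ∫ y, (|q y| + |s y|))) with hK
  have hK0 : 0 ≤ K := Real.sqrt_nonneg _
  have hν0 : Tendsto (fun i => ‖ν i‖) l (𝓝 0) := by simpa using hν.norm
  have hw0 : Tendsto (fun i => ‖(w i)⁻¹‖) l (𝓝 0) := by simpa using hw.norm
  have hν1 : ∀ᶠ i in l, ‖ν i‖ ≤ 1 := (hν0.eventually_lt_const one_pos).mono fun i hi => hi.le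
  have hbound : ∀ᶠ i in l, (∀ x, ‖P i x‖ ≤ K) ∧ ∀ x, ‖R i x‖ ≤ K := by
    filter_upwards [h, hν1] with i hi hi1
    have := hi.2.2.norm_sq_add_norm_sq_le hq hs hqi hsi hi1 hi.1
    refine ⟨fun x => Real.le_sqrt_of_sq_le ?_, fun x => Real.le_sqrt_of_sq_le ?_⟩
    · nlinarith [this x, sq_nonneg ‖R i x‖]
    · nlinarith [this x, sq_nonneg ‖P i x‖]
  have hR : ∀ δ > 0, ∀ᶠ i in l, ∀ x, ‖R i x‖ ≤ δ := by
    intro δ hδ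
    -- With this tolerance the approximation error contributes `K δ / (2(K + 1)) < δ`; the `+ 1`
    -- covers `K = 0`. Once `β` is fixed, the other terms vanish in the limit.
    obtain ⟨β, hβs, hβ, hβb⟩ := (memLp_one_iff_integrable.2 hbi).exist_eLpNorm_sub_le
      ENNReal.one_ne_top le_rfl (ε := δ / (2 * (K + 1))) (by positivity)
    have hβi : Integrable β := hβ.continuous.integrable_of_hasCompactSupport hβs
    have hβb' : ∫ y, |b y - β y| ≤ δ / (2 * (K + 1)) := by
      rw [eLpNorm_one_eq_lintegral_enorm] at hβb
      have e := ofReal_integral_norm_eq_lintegral_enorm (hbi.sub hβi)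
      rw [← e] at hβb
      exact (ENNReal.ofReal_le_ofReal_iff (by positivity)).1 hβb
    obtain ⟨M, hM⟩ := hβs.exists_bound_of_continuous hβ.continuous
    have hlim : Tendsto (fun i => K * (δ / (2 * (K + 1)) + ‖ν i‖ * (∫ y, (|q y| + |s y|)) +
        ‖(w i)⁻¹‖ * ((∫ y, |deriv β y|) + M * ∫ y, (|q y| + |s y| + |b y|))) + ‖(w i)⁻¹‖ * M * K) l
        (𝓝 (K * (δ / (2 * (K + 1)) + 0 * (∫ y, (|q y| + |s y|)) +
        0 * ((∫ y, |deriv β y|) + M * ∫ y, (|q y| + |s y| + |b y|))) + 0 * M * K)) :=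
      ((((hν0.mul_const _).const_add _).add (hw0.mul_const _)).const_mul K).add
        ((hw0.mul_const M).mul_const K)
    have hlt : K * (δ / (2 * (K + 1)) + 0 * (∫ y, (|q y| + |s y|)) +
        0 * ((∫ y, |deriv β y|) + M * ∫ y, (|q y| + |s y| + |b y|))) + 0 * M * K < δ := by
      simp only [zero_mul, add_zero]
      rw [mul_div_assoc', div_lt_iff₀ (by positivity)]
      nlinarith
    filter_upwards [h, hν1, hbound, hlim.eventually_lt_const hlt] with i hi hi1 hib hil x
    refine (hi.2.2.norm_snd_le hq hs hb hqi hsi hbi hi1 hi.1 hi.2.1 hib.1 hib.2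
      (hβ.of_le (by exact_mod_cast le_top)) hβs hM x).trans (le_trans ?_ hil.le)
    gcongr
  refine ⟨tendsto_iff_norm_sub_tendsto_zero.2 ?_, tendsto_zero_iff_norm_tendsto_zero.2 ?_⟩
  · refine tendsto_order.2 ⟨fun a ha => Eventually.of_forall fun i => ha.trans_le (norm_nonneg _),
      fun δ hδ => ?_⟩
    set B := ∫ y, |b y| with hB
    have hB0 : 0 ≤ B := integral_nonneg fun y => abs_nonneg _
    have hlim : Tendsto (fun i => ‖ν i‖ * K * (∫ y, (|q y| + |s y|)) + δ / (2 * (B + 1)) * B) l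
        (𝓝 (0 * K * (∫ y, (|q y| + |s y|)) + δ / (2 * (B + 1)) * B)) :=
      ((hν0.mul_const K).mul_const _).add_const _
    have hlt : 0 * K * (∫ y, (|q y| + |s y|)) + δ / (2 * (B + 1)) * B < δ := by
      rw [zero_mul, zero_mul, zero_add, div_mul_eq_mul_div, div_lt_iff₀ (by positivity)]
      nlinarith
    filter_upwards [h, hbound, hR (δ / (2 * (B + 1))) (by positivity),
      hlim.eventually_lt_const hlt] with i hi hib hiR hil
    exact (hi.2.2.norm_fst_sub_le hq hs hb hqi hsi hbi hib.1 hib.2 hiR x).trans_lt hil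
  · refine tendsto_order.2 ⟨fun a ha => Eventually.of_forall fun i => ha.trans_le (norm_nonneg _),
      fun δ hδ => ?_⟩
    filter_upwards [hR (δ / 2) (by positivity)] with i hi
    exact (hi x).trans_lt (by linarith)

end IsRotatedSystem

/-! ### The first column of `M⁻` -/

/-- Potentials `f`, `f'`, `g` regular enough for the scattering problem to be a classical system of
differential equations. -/
structure IsPotential (f f' g : ℝ → ℝ) : Prop where
  hasDerivAt : ∀ x, HasDerivAt f (f' x) x
  continuous_deriv : Continuous f'
  continuous_vel : Continuous g
  integrable_deriv : Integrable f'
  integrable_vel : Integrable g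
  integrable_one_sub_cos : Integrable fun x => 1 - Real.cos (f x)
  integrable_sin : Integrable fun x => Real.sin (f x)

/-- The exponent `2iE(z)/ε`. -/
def phase (ε : ℝ) (z : ℂ) : ℂ := 2 * Complex.I * E z / (ε : ℂ)

variable {ε : ℝ} {f f' g : ℝ → ℝ} {z : ℂ} {m : ℝ → Fin 2 → ℂ}

theorem phase_re_nonpos (hε : 0 < ε) (hz : 0 < z.im) : (phase ε z).re ≤ 0 := by
  have h1 : phase ε z = ((2 / ε : ℝ) : ℂ) * (Complex.I * E z) := by
    simp only [phase]
    push_cast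
    ring
  have h2 : 0 ≤ (E z).im := by
    have : (E z).im = (z.im - (z⁻¹).im) / 4 := by
      simp only [E]
      rw [show (4 : ℂ) = ((4 : ℝ) : ℂ) by norm_num, Complex.div_ofReal_im, Complex.sub_im]
    rw [this, Complex.inv_im]
    have : 0 ≤ z.im / Complex.normSq z := div_nonneg hz.le (Complex.normSq_nonneg z)
    rw [neg_div]
    linarith
  rw [h1, Complex.re_ofReal_mul, Complex.I_mul_re]
  have : 0 < 2 / ε := by positivity
  nlinarith

/-- Expresses the rate through the same constant `(4iε)⁻¹` that multiplies `Q`, so that the `z⁻¹`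
terms of the two can be cancelled. -/
theorem phase_eq (hε : ε ≠ 0) (z : ℂ) :
    phase ε z = 2 * ((4 * Complex.I * (ε : ℂ))⁻¹ * z⁻¹ - (4 * Complex.I * (ε : ℂ))⁻¹ * z) := by
  have hε' : (ε : ℂ) ≠ 0 := by exact_mod_cast hε
  have hI : Complex.I⁻¹ = -Complex.I := Complex.inv_I
  simp only [phase, E, mul_inv, hI]
  field_simp
  ring

theorem integrand_zero_apply_zero (x y : ℝ) :
    integrand ε f f' g z 0 m x y 0 = Q ε f f' g z y 0 0 * m y 0 + Q ε f f' g z y 0 1 * m y 1 := by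
  simp only [integrand, expSigma, Matrix.mulVec, dotProduct, Fin.sum_univ_two, Pi.smul_apply,
    Matrix.of_apply, Matrix.cons_val_zero, Matrix.cons_val_one, Matrix.cons_val', zero_mul,
    add_zero, smul_eq_mul]
  rw [← mul_assoc, ← Complex.exp_add, add_neg_cancel, Complex.exp_zero, one_mul]

theorem integrand_zero_apply_one (x y : ℝ) :
    integrand ε f f' g z 0 m x y 1 = Complex.exp (phase ε z * ((x - y : ℝ) : ℂ)) *
      (Q ε f f' g z y 1 0 * m y 0 + Q ε f f' g z y 1 1 * m y 1) := by
  simp only [integrand, expSigma, Matrix.mulVec, dotProduct, Fin.sum_univ_two, Pi.smul_apply,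
    Matrix.of_apply, Matrix.cons_val_zero, Matrix.cons_val_one, Matrix.cons_val', zero_mul,
    zero_add, smul_eq_mul, neg_neg]
  rw [← mul_assoc, ← Complex.exp_add]
  congr 2
  simp only [phase]
  ring

namespace IsPotential

theorem continuous (hp : IsPotential f f' g) : Continuous f :=
  continuous_iff_continuousAt.2 fun x => (hp.hasDerivAt x).continuousAt

theorem continuous_Q (hp : IsPotential f f' g) (i j : Fin 2) : Continuous fun x => Q ε f f' g z x i j := by
  have h1 := hp.continuous
  have h2 := hp.continuous_deriv
  have h3 := hp.continuous_vel
  fin_cases i <;> fin_cases j <;> simp [Q] <;> fun_prop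

theorem integrable_Q (hp : IsPotential f f' g) (i j : Fin 2) : Integrable fun x => Q ε f f' g z x i j := by
  have h1 : Integrable fun x => z⁻¹ * ((1 - Real.cos (f x) : ℝ) : ℂ) :=
    hp.integrable_one_sub_cos.ofReal.const_mul _
  have h2 : Integrable fun x => z⁻¹ * ((Real.sin (f x) : ℝ) : ℂ) :=
    hp.integrable_sin.ofReal.const_mul _
  have h3 : Integrable fun x => Complex.I * ((ε * f' x + g x : ℝ) : ℂ) :=
    ((hp.integrable_deriv.const_mul ε).add hp.integrable_vel).ofReal.const_mul _
  fin_cases i <;> fin_cases j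
  exacts [h1, h2.neg.sub h3, h2.neg.add h3, h1.neg]

theorem integrable_row (hp : IsPotential f f' g) (κ : ℂ) (hm : Continuous m) {B : ℝ} (hB : ∀ x, ‖m x‖ ≤ B) (i : Fin 2) :
    (Continuous fun y => κ * Q ε f f' g z y i 0 * m y 0 + κ * Q ε f f' g z y i 1 * m y 1) ∧
    Integrable fun y => κ * Q ε f f' g z y i 0 * m y 0 + κ * Q ε f f' g z y i 1 * m y 1 := by
  have hc : ∀ j, Continuous fun y => m y j := fun j => (continuous_apply j).comp hm
  have hb : ∀ j, Integrable fun y => κ * Q ε f f' g z y i j * m y j := fun j =>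
    ((hp.integrable_Q i j).const_mul κ).mul_bdd (hc j).aestronglyMeasurable
      (Eventually.of_forall fun y => (norm_le_pi_norm (m y) j).trans (hB y))
  have hq := fun j => hp.continuous_Q (ε := ε) (z := z) i j
  exact ⟨((continuous_const.mul (hq 0)).mul (hc 0)).add ((continuous_const.mul (hq 1)).mul (hc 1)),
    (hb 0).add (hb 1)⟩

/-- The first column of the integral equation for `M⁻` in components. -/
theorem isMMinus_zero_iff (hp : IsPotential f f' g) (hw : (phase ε z).re ≤ 0) :
    IsMMinus ε f f' g z 0 m ↔ Continuous m ∧ (∃ B : ℝ, ∀ x, ‖m x‖ ≤ B) ∧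
      (∀ x, m x 0 = 1 + expInt 0 (fun y => (4 * Complex.I * (ε : ℂ))⁻¹ * Q ε f f' g z y 0 0 * m y 0 +
        (4 * Complex.I * (ε : ℂ))⁻¹ * Q ε f f' g z y 0 1 * m y 1) x) ∧
      ∀ x, m x 1 = expInt (phase ε z)
        (fun y => (4 * Complex.I * (ε : ℂ))⁻¹ * Q ε f f' g z y 1 0 * m y 0 +
          (4 * Complex.I * (ε : ℂ))⁻¹ * Q ε f f' g z y 1 1 * m y 1) x := by
  unfold IsMMinus
  refine and_congr_right fun hm => and_congr_right fun ⟨B, hB⟩ => ?_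
  rw [← forall_and]
  refine forall_congr' fun x => ?_
  set κ := (4 * Complex.I * (ε : ℂ))⁻¹
  have hi0 : IntegrableOn (fun y => integrand ε f f' g z 0 m x y 0) (Iic x) := by
    simp only [integrand_zero_apply_zero]
    simpa using (hp.integrable_row (ε := ε) (z := z) 1 hm hB 0).2.integrableOn
  have hi1 : IntegrableOn (fun y => integrand ε f f' g z 0 m x y 1) (Iic x) := by
    simp only [integrand_zero_apply_one]
    refine integrableOn_exp_mul hw ?_ x
    simpa using (hp.integrable_row (ε := ε) (z := z) 1 hm hB 1).2
  have hi : ∀ i, Integrable (fun y => integrand ε f f' g z 0 m x y i) (volume.restrict (Iic x)) := by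
    intro i
    fin_cases i
    exacts [hi0, hi1]
  have e0 : κ * ∫ y in Iic x, integrand ε f f' g z 0 m x y 0
      = expInt 0 (fun y => κ * Q ε f f' g z y 0 0 * m y 0 + κ * Q ε f f' g z y 0 1 * m y 1) x := by
    rw [expInt_zero_left, ← integral_const_mul]
    simp only [integrand_zero_apply_zero]
    congr 1
    funext y
    ring
  have e1 : κ * ∫ y in Iic x, integrand ε f f' g z 0 m x y 1 = expInt (phase ε z)
      (fun y => κ * Q ε f f' g z y 1 0 * m y 0 + κ * Q ε f f' g z y 1 1 * m y 1) x := by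
    rw [expInt, ← integral_const_mul]
    simp only [integrand_zero_apply_one]
    congr 1
    funext y
    ring
  rw [funext_iff, Fin.forall_fin_two]
  simp only [Pi.add_apply, Pi.smul_apply, eval_integral hi, smul_eq_mul, e0, e1]
  simp

theorem exists_isMMinus_zero (hp : IsPotential f f' g) (hε : 0 < ε) (hz : 0 < z.im) :
    ∃ m, IsMMinus ε f f' g z 0 m := by
  have hw := phase_re_nonpos hε hz
  set κ := (4 * Complex.I * (ε : ℂ))⁻¹ with hκ
  have hc : ∀ i j, Continuous fun x => κ * Q ε f f' g z x i j := fun i j =>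
    continuous_const.mul (hp.continuous_Q i j)
  have hi : ∀ i j, Integrable fun x => ‖κ * Q ε f f' g z x i j‖ := fun i j =>
    ((hp.integrable_Q i j).const_mul κ).norm
  obtain ⟨p, r, hpc, hrc, ⟨B, hB⟩, h0, h1⟩ := exists_volterra_solution
    (q := fun x => (‖κ * Q ε f f' g z x 0 0‖ + ‖κ * Q ε f f' g z x 0 1‖) +
      (‖κ * Q ε f f' g z x 1 0‖ + ‖κ * Q ε f f' g z x 1 1‖)) hw
    (((hc 0 0).norm.add (hc 0 1).norm).add ((hc 1 0).norm.add (hc 1 1).norm))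
    (((hi 0 0).add (hi 0 1)).add ((hi 1 0).add (hi 1 1))) (hc 0 0) (hc 0 1) (hc 1 0) (hc 1 1)
    (fun x => le_add_of_nonneg_right (by positivity))
    (fun x => le_add_of_nonneg_left (by positivity))
  refine ⟨fun x => ![p x, r x], (hp.isMMinus_zero_iff hw).2 ⟨?_, ⟨B, fun x => ?_⟩, ?_, ?_⟩⟩
  · refine continuous_pi fun i => ?_
    fin_cases i
    exacts [hpc, hrc]
  · refine (pi_norm_le_iff_of_nonneg ((norm_nonneg _).trans (hB x).1)).2 fun i => ?_
    fin_cases i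
    exacts [(hB x).1, (hB x).2]
  · simpa only [Matrix.cons_val_zero, Matrix.cons_val_one] using h0
  · simpa only [Matrix.cons_val_zero, Matrix.cons_val_one] using h1

/-- In the rotating frame, the first column of `M⁻` solves a system without singularity
in its coefficients at `z = 0`. -/
theorem isRotatedSystem (hp : IsPotential f f' g) (hε : 0 < ε) (hz : 0 < z.im) {C : ℝ}
    (hcos : Tendsto (fun x => Real.cos (f x / 2)) atBot (𝓝 C))
    (hsin : Tendsto (fun x => Real.sin (f x / 2)) atBot (𝓝 0)) (hm : IsMMinus ε f f' g z 0 m) :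
    IsRotatedSystem (fun x => 1 - Real.cos (f x)) (fun x => Real.sin (f x))
      (fun x => f' x / 4 - g x / (4 * ε)) ((4 * Complex.I * (ε : ℂ))⁻¹ * z) (phase ε z) C
      (fun x => (Real.cos (f x / 2) : ℂ) * m x 0 + (Real.sin (f x / 2) : ℂ) * m x 1)
      (fun x => -(Real.sin (f x / 2) : ℂ) * m x 0 + (Real.cos (f x / 2) : ℂ) * m x 1) := by
  have hw := phase_re_nonpos hε hz
  obtain ⟨hmc, ⟨B, hB⟩, h0, h1⟩ := (hp.isMMinus_zero_iff hw).1 hm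
  set κ := (4 * Complex.I * (ε : ℂ))⁻¹ with hκ
  obtain ⟨c0, i0⟩ := hp.integrable_row (ε := ε) (z := z) κ hmc hB 0
  obtain ⟨c1, i1⟩ := hp.integrable_row (ε := ε) (z := z) κ hmc hB 1
  have d0 := fun x => (hasDerivAt_expInt (w := 0) le_rfl c0 i0 x).const_add 1
  have d1 := hasDerivAt_expInt hw c1 i1
  have t0 := (tendsto_expInt_atBot (w := 0) le_rfl i0).const_add 1
  have t1 := tendsto_expInt_atBot hw i1
  have s0 : ∀ x, HasDerivAt (fun x => m x 0) (κ * Q ε f f' g z x 0 0 * m x 0 +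
      κ * Q ε f f' g z x 0 1 * m x 1) x := fun x => by
    simpa only [← h0, zero_mul, zero_add] using d0 x
  have s1 : ∀ x, HasDerivAt (fun x => m x 1) (phase ε z * m x 1 +
      (κ * Q ε f f' g z x 1 0 * m x 0 + κ * Q ε f f' g z x 1 1 * m x 1)) x := fun x => by
    have := d1 x
    rw [← funext h1] at this
    exact this
  have hε' : (ε : ℂ) ≠ 0 := by exact_mod_cast hε.ne'
  have hκI : κ * Complex.I = 1 / (4 * (ε : ℂ)) := by
    rw [hκ]
    field_simp
  have dc : ∀ x, HasDerivAt (fun x => (Real.cos (f x / 2) : ℂ))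
      (-(Real.sin (f x / 2) : ℂ) * ((f' x / 2 : ℝ) : ℂ)) x := fun x => by
    simpa using ((hp.hasDerivAt x).div_const 2).cos.ofReal_comp
  have ds : ∀ x, HasDerivAt (fun x => (Real.sin (f x / 2) : ℂ))
      ((Real.cos (f x / 2) : ℂ) * ((f' x / 2 : ℝ) : ℂ)) x := fun x => by
    simpa using ((hp.hasDerivAt x).div_const 2).sin.ofReal_comp
  have dns : ∀ x, HasDerivAt (fun x => -(Real.sin (f x / 2) : ℂ))
      (-((Real.cos (f x / 2) : ℂ) * ((f' x / 2 : ℝ) : ℂ))) x := fun x => (ds x).neg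
  have hd : ∀ x, κ * (Complex.I * ((ε * f' x + g x : ℝ) : ℂ))
      = ((f' x / 4 + g x / (4 * ε) : ℝ) : ℂ) := fun x => by
    rw [← mul_assoc, hκI]
    push_cast
    field_simp
  have hcf : ∀ x, ((1 - Real.cos (f x) : ℝ) : ℂ) = 2 * (Real.sin (f x / 2) : ℂ) ^ 2 := fun x => by
    have h2 : Real.cos (f x) = 1 - 2 * Real.sin (f x / 2) ^ 2 := by
      rw [← Real.cos_two_mul_eq_one_sub, show 2 * (f x / 2) = f x by ring]
    rw [h2]
    push_cast
    ring
  have hsf : ∀ x, ((Real.sin (f x) : ℝ) : ℂ)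
      = 2 * (Real.sin (f x / 2) : ℂ) * (Real.cos (f x / 2) : ℂ) := fun x => by
    have h2 : Real.sin (f x) = 2 * Real.sin (f x / 2) * Real.cos (f x / 2) := by
      rw [← Real.sin_two_mul, show 2 * (f x / 2) = f x by ring]
    rw [h2]
    push_cast
    ring
  have hcs : ∀ x, (Real.cos (f x / 2) : ℂ) ^ 2 + (Real.sin (f x / 2) : ℂ) ^ 2 = 1 := fun x => by
    exact_mod_cast Real.cos_sq_add_sin_sq (f x / 2)
  -- Differentiating the rotation contributes `f' / 2`, and the off-diagonal part of `Q` takes away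
  -- `f'/4 + g/(4ε)`.
  have hb : ∀ x, ((f' x / 4 - g x / (4 * ε) : ℝ) : ℂ)
      = ((f' x / 2 : ℝ) : ℂ) - ((f' x / 4 + g x / (4 * ε) : ℝ) : ℂ) := fun x => by
    push_cast
    ring
  have q00 : ∀ x, κ * Q ε f f' g z x 0 0 = κ * z⁻¹ * ((1 - Real.cos (f x) : ℝ) : ℂ) := fun x => by
    simp only [Q, Matrix.of_apply, Matrix.cons_val_zero, Matrix.cons_val', mul_assoc]
  have q01 : ∀ x, κ * Q ε f f' g z x 0 1 = -(κ * z⁻¹ * ((Real.sin (f x) : ℝ) : ℂ)) -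
      ((f' x / 4 + g x / (4 * ε) : ℝ) : ℂ) := fun x => by
    rw [← hd]
    simp only [Q, Matrix.of_apply, Matrix.cons_val_zero, Matrix.cons_val_one, Matrix.cons_val']
    ring
  have q10 : ∀ x, κ * Q ε f f' g z x 1 0 = -(κ * z⁻¹ * ((Real.sin (f x) : ℝ) : ℂ)) +
      ((f' x / 4 + g x / (4 * ε) : ℝ) : ℂ) := fun x => by
    rw [← hd]
    simp only [Q, Matrix.of_apply, Matrix.cons_val_zero, Matrix.cons_val_one, Matrix.cons_val']
    ring
  have q11 : ∀ x, κ * Q ε f f' g z x 1 1 = -(κ * z⁻¹ * ((1 - Real.cos (f x) : ℝ) : ℂ)) := fun x => by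
    change κ * -(z⁻¹ * ((1 - Real.cos (f x) : ℝ) : ℂ)) = _
    ring
  have tc : Tendsto (fun x => (Real.cos (f x / 2) : ℂ)) atBot (𝓝 (C : ℂ)) :=
    (Complex.continuous_ofReal.tendsto _).comp hcos
  have ts : Tendsto (fun x => (Real.sin (f x / 2) : ℂ)) atBot (𝓝 0) := by
    have := (Complex.continuous_ofReal.tendsto _).comp hsin
    rwa [Complex.ofReal_zero] at this
  simp only [← h0, add_zero] at t0
  rw [← funext h1] at t1
  refine ⟨fun x => ?_, fun x => ?_, ?_, ?_⟩
  · refine (((dc x).mul (s0 x)).add ((ds x).mul (s1 x))).congr_deriv ?_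
    -- After the half-angle substitutions the `z⁻¹` terms cancel modulo `cos² + sin² = 1`; what
    -- survives of them has the factor `κ z`.
    simp only [q00, q01, q10, q11, phase_eq hε.ne', ← hκ, hcf, hsf, hb]
    linear_combination (-2 * (Real.sin (f x / 2) : ℂ) * (κ * z⁻¹ - κ * z) * m x 1) * hcs x
  · refine (((dns x).mul (s0 x)).add ((dc x).mul (s1 x))).congr_deriv ?_
    simp only [q00, q01, q10, q11, phase_eq hε.ne', ← hκ, hcf, hsf, hb]
    linear_combination (-2 * (Real.sin (f x / 2) : ℂ) * (κ * z⁻¹ - κ * z) * m x 0) * hcs x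
  · simpa using (tc.mul t0).add (ts.mul t1)
  · simpa using (ts.neg.mul t0).add (tc.mul t1)

/-- The limit of the first column of `M⁻` at `z = 0` from the upper half-plane. -/
theorem tendsto_isMMinus_zero (hp : IsPotential f f' g) (hε : 0 < ε) {C : ℝ}
    (hcos : Tendsto (fun x => Real.cos (f x / 2)) atBot (𝓝 C))
    (hsin : Tendsto (fun x => Real.sin (f x / 2)) atBot (𝓝 0)) {M : ℂ → ℝ → Fin 2 → ℂ}
    (hM : ∀ z, 0 < z.im → IsMMinus ε f f' g z 0 (M z)) (x : ℝ) :
    Tendsto (fun z => M z x) (𝓝[{z | 0 < z.im}] 0)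
      (𝓝 ![(C * Real.cos (f x / 2) : ℂ), C * Real.sin (f x / 2)]) := by
  have hq : Continuous fun x => 1 - Real.cos (f x) :=
    continuous_const.sub (Real.continuous_cos.comp hp.continuous)
  have hs : Continuous fun x => Real.sin (f x) := Real.continuous_sin.comp hp.continuous
  have hb : Continuous fun x => f' x / 4 - g x / (4 * ε) :=
    (hp.continuous_deriv.div_const _).sub (hp.continuous_vel.div_const _)
  have hbi : Integrable fun x => f' x / 4 - g x / (4 * ε) :=
    (hp.integrable_deriv.div_const _).sub (hp.integrable_vel.div_const _)
  set κ := (4 * Complex.I * (ε : ℂ))⁻¹ with hκ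
  have hκ0 : κ ≠ 0 := by
    have hε' : (ε : ℂ) ≠ 0 := by exact_mod_cast hε.ne'
    rw [hκ]
    simp [hε']
  have hid : Tendsto (fun z : ℂ => z) (𝓝[{z | 0 < z.im}] 0) (𝓝 0) := tendsto_id.mono_left inf_le_left
  have hν : Tendsto (fun z => κ * z) (𝓝[{z | 0 < z.im}] 0) (𝓝 0) := by
    simpa using hid.const_mul κ
  have hphase : ∀ z : ℂ, 0 < z.im → (phase ε z)⁻¹ = (2 * κ)⁻¹ * (z / (1 - z ^ 2)) ∧
      phase ε z ≠ 0 := by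
    intro z hz
    have hz0 : z ≠ 0 := by
      rintro rfl
      simp at hz
    -- The rate vanishes only at `z = ±1`, which are real.
    have hz1 : 1 - z ^ 2 ≠ 0 := by
      intro h
      have : (1 - z) * (1 + z) = 0 := by linear_combination h
      rcases mul_eq_zero.1 this with h | h
      · have := congrArg Complex.im h
        simp at this
        linarith
      · have := congrArg Complex.im h
        simp at this
        linarith
    have e : phase ε z = 2 * κ * ((1 - z ^ 2) / z) := by
      rw [phase_eq hε.ne', ← hκ]
      field_simp
    rw [e, mul_inv, inv_div]
    exact ⟨rfl, mul_ne_zero (mul_ne_zero two_ne_zero hκ0) (div_ne_zero hz1 hz0)⟩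
  have hw : Tendsto (fun z => (phase ε z)⁻¹) (𝓝[{z | 0 < z.im}] 0) (𝓝 0) := by
    have h1 : Tendsto (fun z : ℂ => (2 * κ)⁻¹ * (z / (1 - z ^ 2))) (𝓝[{z | 0 < z.im}] 0)
        (𝓝 ((2 * κ)⁻¹ * (0 / (1 - 0 ^ 2)))) :=
      (hid.div ((hid.pow 2).const_sub 1) (by simp)).const_mul _
    rw [zero_div, mul_zero] at h1
    exact h1.congr' (eventually_nhdsWithin_of_forall fun z hz => (hphase z hz).1.symm)
  obtain ⟨hP, hR⟩ := IsRotatedSystem.tendsto_const hq hs hb hp.integrable_one_sub_cos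
    hp.integrable_sin hbi hν hw (eventually_nhdsWithin_of_forall fun z hz =>
      ⟨phase_re_nonpos hε hz, (hphase z hz).2, hp.isRotatedSystem hε hz hcos hsin (hM z hz)⟩) x
  have hcs : (Real.cos (f x / 2) : ℂ) ^ 2 + (Real.sin (f x / 2) : ℂ) ^ 2 = 1 := by
    exact_mod_cast Real.cos_sq_add_sin_sq (f x / 2)
  -- The rotation is inverted: the components of the column are `cos(f/2) P - sin(f/2) R` and
  -- `sin(f/2) P + cos(f/2) R`.
  refine tendsto_pi_nhds.2 (Fin.forall_fin_two.2 ⟨?_, ?_⟩)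
  · have := (hP.const_mul (Real.cos (f x / 2) : ℂ)).sub (hR.const_mul (Real.sin (f x / 2) : ℂ))
    rw [mul_zero, sub_zero, mul_comm] at this
    refine this.congr fun z => ?_
    linear_combination (M z x 0) * hcs
  · have := (hP.const_mul (Real.sin (f x / 2) : ℂ)).add (hR.const_mul (Real.cos (f x / 2) : ℂ))
    rw [mul_zero, add_zero, mul_comm] at this
    refine this.congr fun z => ?_
    linear_combination (M z x 1) * hcs

end IsPotential

/-! ### Symmetries, and the remaining columns -/

variable {k : Fin 2}

theorem E_neg (z : ℂ) : E (-z) = -E z := by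
  simp only [E, inv_neg]
  ring

/-- Only the almost-everywhere classes of `f'` and `g` enter the integral equations. -/
theorem integrand_ae_eq {f₁' g₁ : ℝ → ℝ} (hf : f' =ᵐ[volume] f₁') (hg : g =ᵐ[volume] g₁) (x : ℝ) :
    integrand ε f f' g z k m x =ᵐ[volume] integrand ε f f₁' g₁ z k m x := by
  filter_upwards [hf, hg] with y h1 h2
  simp only [integrand, Q, h1, h2]

theorem isMPlus_congr {f₁' g₁ : ℝ → ℝ} (hf : f' =ᵐ[volume] f₁') (hg : g =ᵐ[volume] g₁) :
    IsMPlus ε f f' g = IsMPlus ε f f₁' g₁ := by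
  funext z k m
  have h := fun x => integral_congr_ae (ae_restrict_of_ae (s := Ioi x)
    (integrand_ae_eq (ε := ε) (f := f) (z := z) (k := k) (m := m) hf hg x))
  simp only [IsMPlus, h]

theorem isMMinus_congr {f₁' g₁ : ℝ → ℝ} (hf : f' =ᵐ[volume] f₁') (hg : g =ᵐ[volume] g₁) :
    IsMMinus ε f f' g = IsMMinus ε f f₁' g₁ := by
  funext z k m
  have h := fun x => integral_congr_ae (ae_restrict_of_ae (s := Iic x)
    (integrand_ae_eq (ε := ε) (f := f) (z := z) (k := k) (m := m) hf hg x))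
  simp only [IsMMinus, h]

/-- The columns are chosen by `Classical.epsilon`, so the defining predicates themselves must be
equal; the choices then coincide. -/
theorem G_congr {f₁' g₁ : ℝ → ℝ} (hf : f' =ᵐ[volume] f₁') (hg : g =ᵐ[volume] g₁) :
    G ε f f' g = G ε f f₁' g₁ := by
  funext x z
  simp only [G, S11, S22, jPlus, jMinus, mPlus, mMinus, isMPlus_congr hf hg, isMMinus_congr hf hg]

/-- `f'` changes sign by the chain rule; `g` is given the same sign so that `ε f' + g` flips as a
whole, while `z ↦ -z` flips the `z⁻¹` terms. -/
theorem Q_reflect (y : ℝ) :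
    Q ε (fun x => f (-x)) (fun x => -f' (-x)) (fun x => -g (-x)) (-z) y = -Q ε f f' g z (-y) := by
  ext i j
  fin_cases i <;> fin_cases j <;> simp [Q] <;> ring

theorem integrand_reflect (x y : ℝ) :
    integrand ε (fun x => f (-x)) (fun x => -f' (-x)) (fun x => -g (-x)) (-z) k (fun x => m (-x)) x y
      = -integrand ε f f' g z k m (-x) (-y) := by
  have e : Complex.I * E (-z) * ((x - y : ℝ) : ℂ) / (ε : ℂ)
      = Complex.I * E z * ((-x - -y : ℝ) : ℂ) / (ε : ℂ) := by
    rw [E_neg]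
    push_cast
    ring
  simp only [integrand, e, Q_reflect, Matrix.neg_mulVec, Matrix.mulVec_neg, smul_neg]

/-- Reflection in space exchanges `M⁺` and `M⁻`. -/
theorem isMMinus_reflect_iff :
    IsMMinus ε (fun x => f (-x)) (fun x => -f' (-x)) (fun x => -g (-x)) (-z) k (fun x => m (-x)) ↔
      IsMPlus ε f f' g z k m := by
  refine and_congr ⟨fun h => ?_, fun h => h.comp continuous_neg⟩ (and_congr (exists_congr fun B =>
    ⟨fun h x => ?_, fun h x => h (-x)⟩) ?_)
  · simpa [Function.comp_def] using h.comp continuous_neg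
  · simpa using h (-x)
  · have h1 : ∀ x, ∫ y in Iic x, integrand ε (fun x => f (-x)) (fun x => -f' (-x))
        (fun x => -g (-x)) (-z) k (fun x => m (-x)) x y
        = -∫ y in Ioi (-x), integrand ε f f' g z k m (-x) y := by
      intro x
      simp only [integrand_reflect]
      rw [integral_neg, integral_comp_neg_Iic x fun y => integrand ε f f' g z k m (-x) y]
    simp only [h1, smul_neg, ← sub_eq_add_neg]
    refine ⟨fun h x => ?_, fun h x => h (-x)⟩
    simpa using h (-x)

/-- The rotation `(a, b) ↦ (b, -a)`. -/
def quarterTurn : (Fin 2 → ℂ) ≃L[ℂ] (Fin 2 → ℂ) :=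
  LinearEquiv.toContinuousLinearEquiv
    { toFun := fun v => ![v 1, -v 0]
      invFun := fun v => ![-v 1, v 0]
      map_add' := fun v v' => by
        ext i
        fin_cases i <;> simp [add_comm]
      map_smul' := fun a v => by
        ext i
        fin_cases i <;> simp
      left_inv := fun v => by
        ext i
        fin_cases i <;> simp
      right_inv := fun v => by
        ext i
        fin_cases i <;> simp }

theorem quarterTurn_apply (v : Fin 2 → ℂ) : quarterTurn v = ![v 1, -v 0] := rfl

theorem quarterTurn_symm_apply (v : Fin 2 → ℂ) : quarterTurn.symm v = ![-v 1, v 0] := rfl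

/-- The quarter turn anticommutes with `σ₃` and with the symmetric `z⁻¹` part of `Q`, and commutes
with its antisymmetric part; `z ↦ -z` compensates the signs. -/
theorem integrand_quarterTurn (x y : ℝ) :
    integrand ε f f' g (-z) 0 (fun x => quarterTurn (m x)) x y
      = quarterTurn (integrand ε f f' g z 1 m x y) := by
  have e : Complex.I * E (-z) * ((x - y : ℝ) : ℂ) / (ε : ℂ)
      = -(Complex.I * E z * ((x - y : ℝ) : ℂ) / (ε : ℂ)) := by
    rw [E_neg]
    ring
  simp only [integrand, e, quarterTurn_apply]
  ext i
  fin_cases i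
  · simp [expSigma, Q, dotProduct, Fin.sum_univ_two]
    ring
  · simp [expSigma, Q, dotProduct, Fin.sum_univ_two]
    ring

/-- The second column at `z` is a rotation of the first column at `-z`. -/
theorem isMMinus_quarterTurn_iff :
    IsMMinus ε f f' g (-z) 0 (fun x => quarterTurn (m x)) ↔ IsMMinus ε f f' g z 1 m := by
  have hnorm : ∀ v : Fin 2 → ℂ, ‖quarterTurn v‖ = ‖v‖ := by
    intro v
    simp only [quarterTurn_apply, Pi.norm_def, Fin.univ_succ]
    simp [max_comm]
  refine and_congr quarterTurn.toHomeomorph.comp_continuous_iff (and_congr (by simp only [hnorm])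
    (forall_congr' fun x => ?_))
  have h1 : ∫ y in Iic x, integrand ε f f' g (-z) 0 (fun x => quarterTurn (m x)) x y
      = quarterTurn (∫ y in Iic x, integrand ε f f' g z 1 m x y) := by
    simp only [integrand_quarterTurn]
    exact quarterTurn.integral_comp_comm _
  have h2 : (Pi.single 0 1 : Fin 2 → ℂ) = quarterTurn (Pi.single 1 1) := by
    ext i
    fin_cases i <;> simp [quarterTurn_apply]
  rw [h1, h2, ← map_smul, ← map_add, quarterTurn.injective.eq_iff]

theorem tendsto_neg_lower_upper :
    Tendsto (fun z : ℂ => -z) (𝓝[{z | z.im < 0}] 0) (𝓝[{z | 0 < z.im}] 0) := by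
  refine tendsto_nhdsWithin_iff.2 ⟨?_, eventually_nhdsWithin_of_forall fun z hz => ?_⟩
  · have : Tendsto (fun z : ℂ => -z) (𝓝 0) (𝓝 (-0)) := continuous_neg.tendsto 0
    rw [neg_zero] at this
    exact this.mono_left inf_le_left
  · have hz' : z.im < 0 := hz
    simpa using hz'

theorem tendsto_neg_upper_lower :
    Tendsto (fun z : ℂ => -z) (𝓝[{z | 0 < z.im}] 0) (𝓝[{z | z.im < 0}] 0) := by
  refine tendsto_nhdsWithin_iff.2 ⟨?_, eventually_nhdsWithin_of_forall fun z hz => ?_⟩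
  · have : Tendsto (fun z : ℂ => -z) (𝓝 0) (𝓝 (-0)) := continuous_neg.tendsto 0
    rw [neg_zero] at this
    exact this.mono_left inf_le_left
  · have hz' : 0 < z.im := hz
    simpa using hz'

namespace IsPotential

theorem reflect (hp : IsPotential f f' g) :
    IsPotential (fun x => f (-x)) (fun x => -f' (-x)) (fun x => -g (-x)) where
  hasDerivAt x :=
    ((hp.hasDerivAt (-x)).comp x (hasDerivAt_neg x)).congr_deriv (mul_neg_one _)
  continuous_deriv := (hp.continuous_deriv.comp continuous_neg).neg
  continuous_vel := (hp.continuous_vel.comp continuous_neg).neg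
  integrable_deriv := hp.integrable_deriv.comp_neg.neg
  integrable_vel := hp.integrable_vel.comp_neg.neg
  integrable_one_sub_cos := hp.integrable_one_sub_cos.comp_neg
  integrable_sin := hp.integrable_sin.comp_neg

/-- `f` tends to a multiple of `2π` at `-∞`. -/
theorem exists_tendsto_atBot (hp : IsPotential f f' g) : ∃ C : ℝ, C ^ 2 = 1 ∧
    Tendsto (fun x => Real.cos (f x / 2)) atBot (𝓝 C) ∧
    Tendsto (fun x => Real.sin (f x / 2)) atBot (𝓝 0) := by
  have hf := tendsto_limUnder_of_hasDerivAt_of_integrableOn_Iic (a := 0)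
    (fun x _ => hp.hasDerivAt x) hp.integrable_deriv.integrableOn
  set L := limUnder atBot f
  have h1 : Tendsto (fun x => 1 - Real.cos (f x)) atBot (𝓝 0) := by
    -- An integrable function with integrable derivative vanishes at infinity; this pins the limit
    -- of `f` to a zero of `1 - cos`.
    refine tendsto_zero_of_hasDerivAt_of_integrableOn_Iic (a := 0)
      (f' := fun x => Real.sin (f x) * f' x) (fun x _ => ?_) ?_
      hp.integrable_one_sub_cos.integrableOn
    · simpa using (hp.hasDerivAt x).cos.const_sub 1
    · refine (hp.integrable_deriv.bdd_mul (c := 1)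
        (Real.continuous_sin.comp hp.continuous).aestronglyMeasurable
        (Eventually.of_forall fun x => ?_)).integrableOn
      exact Real.abs_sin_le_one _
  have hcos : Real.cos L = 1 := by
    have h2 := ((Real.continuous_cos.tendsto L).comp hf).const_sub 1
    linarith [tendsto_nhds_unique h1 h2]
  have hs : Real.sin (L / 2) = 0 := by
    have := Real.cos_two_mul_eq_one_sub (L / 2)
    rw [show 2 * (L / 2) = L by ring, hcos] at this
    exact pow_eq_zero_iff (two_ne_zero) |>.1 (by linarith)
  refine ⟨Real.cos (L / 2), ?_, (Real.continuous_cos.tendsto _).comp (hf.div_const 2), ?_⟩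
  · have := Real.sin_sq_add_cos_sq (L / 2)
    rw [hs] at this
    linarith
  · rw [← hs]
    exact (Real.continuous_sin.tendsto _).comp (hf.div_const 2)

theorem exists_isMMinus_one (hp : IsPotential f f' g) (hε : 0 < ε) (hz : z.im < 0) :
    ∃ m, IsMMinus ε f f' g z 1 m := by
  obtain ⟨m, hm⟩ := hp.exists_isMMinus_zero hε (z := -z) (by simpa using hz)
  refine ⟨fun x => quarterTurn.symm (m x), isMMinus_quarterTurn_iff.1 ?_⟩
  simpa using hm

theorem tendsto_isMMinus_one (hp : IsPotential f f' g) (hε : 0 < ε) {C : ℝ}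
    (hcos : Tendsto (fun x => Real.cos (f x / 2)) atBot (𝓝 C))
    (hsin : Tendsto (fun x => Real.sin (f x / 2)) atBot (𝓝 0)) {M : ℂ → ℝ → Fin 2 → ℂ}
    (hM : ∀ z, z.im < 0 → IsMMinus ε f f' g z 1 (M z)) (x : ℝ) :
    Tendsto (fun z => M z x) (𝓝[{z | z.im < 0}] 0)
      (𝓝 ![-(C * Real.sin (f x / 2) : ℂ), C * Real.cos (f x / 2)]) := by
  have h := (hp.tendsto_isMMinus_zero hε hcos hsin (M := fun z x => quarterTurn (M (-z) x))
    (fun z hz => by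
      have := isMMinus_quarterTurn_iff.2 (hM (-z) (by simpa using hz))
      rwa [neg_neg] at this) x).comp tendsto_neg_lower_upper
  have h2 := (quarterTurn.symm.continuous.tendsto _).comp h
  simpa [Function.comp_def, quarterTurn_symm_apply ![_, _]] using h2

theorem exists_isMPlus_zero (hp : IsPotential f f' g) (hε : 0 < ε) (hz : z.im < 0) :
    ∃ m, IsMPlus ε f f' g z 0 m := by
  obtain ⟨m, hm⟩ := hp.reflect.exists_isMMinus_zero hε (z := -z) (by simpa using hz)
  exact ⟨fun x => m (-x), isMMinus_reflect_iff.1 (by simpa using hm)⟩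

theorem exists_isMPlus_one (hp : IsPotential f f' g) (hε : 0 < ε) (hz : 0 < z.im) :
    ∃ m, IsMPlus ε f f' g z 1 m := by
  obtain ⟨m, hm⟩ := hp.reflect.exists_isMMinus_one hε (z := -z) (by simpa using hz)
  exact ⟨fun x => m (-x), isMMinus_reflect_iff.1 (by simpa using hm)⟩

/-- The limit holds for every family of bounded solutions, so existence alone transfers it to the
chosen ones; no uniqueness is needed. -/
theorem tendsto_mMinus_zero (hp : IsPotential f f' g) (hε : 0 < ε) {C : ℝ}
    (hcos : Tendsto (fun x => Real.cos (f x / 2)) atBot (𝓝 C))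
    (hsin : Tendsto (fun x => Real.sin (f x / 2)) atBot (𝓝 0)) (x : ℝ) :
    Tendsto (fun z => mMinus ε f f' g 0 z x) (𝓝[{z | 0 < z.im}] 0)
      (𝓝 ![(C * Real.cos (f x / 2) : ℂ), C * Real.sin (f x / 2)]) :=
  hp.tendsto_isMMinus_zero hε hcos hsin
    (fun _ hz => Classical.epsilon_spec (hp.exists_isMMinus_zero hε hz)) x

theorem tendsto_mMinus_one (hp : IsPotential f f' g) (hε : 0 < ε) {C : ℝ}
    (hcos : Tendsto (fun x => Real.cos (f x / 2)) atBot (𝓝 C))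
    (hsin : Tendsto (fun x => Real.sin (f x / 2)) atBot (𝓝 0)) (x : ℝ) :
    Tendsto (fun z => mMinus ε f f' g 1 z x) (𝓝[{z | z.im < 0}] 0)
      (𝓝 ![-(C * Real.sin (f x / 2) : ℂ), C * Real.cos (f x / 2)]) :=
  hp.tendsto_isMMinus_one hε hcos hsin
    (fun _ hz => Classical.epsilon_spec (hp.exists_isMMinus_one hε hz)) x

/-- Here `C` is the sign at `+∞`, read off as the value at `-∞` of the reflected potential. -/
theorem tendsto_mPlus_zero (hp : IsPotential f f' g) (hε : 0 < ε) {C : ℝ}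
    (hcos : Tendsto (fun x => Real.cos (f (-x) / 2)) atBot (𝓝 C))
    (hsin : Tendsto (fun x => Real.sin (f (-x) / 2)) atBot (𝓝 0)) (x : ℝ) :
    Tendsto (fun z => mPlus ε f f' g 0 z x) (𝓝[{z | z.im < 0}] 0)
      (𝓝 ![(C * Real.cos (f x / 2) : ℂ), C * Real.sin (f x / 2)]) := by
  have h := (hp.reflect.tendsto_isMMinus_zero hε hcos hsin
    (M := fun z x => mPlus ε f f' g 0 (-z) (-x)) (fun z hz => by
      have := isMMinus_reflect_iff.2 (Classical.epsilon_spec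
        (hp.exists_isMPlus_zero hε (z := -z) (by simpa using hz)))
      rwa [neg_neg] at this) (-x)).comp tendsto_neg_lower_upper
  simpa only [Function.comp_def, neg_neg] using h

theorem tendsto_mPlus_one (hp : IsPotential f f' g) (hε : 0 < ε) {C : ℝ}
    (hcos : Tendsto (fun x => Real.cos (f (-x) / 2)) atBot (𝓝 C))
    (hsin : Tendsto (fun x => Real.sin (f (-x) / 2)) atBot (𝓝 0)) (x : ℝ) :
    Tendsto (fun z => mPlus ε f f' g 1 z x) (𝓝[{z | 0 < z.im}] 0)
      (𝓝 ![-(C * Real.sin (f x / 2) : ℂ), C * Real.cos (f x / 2)]) := by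
  have h := (hp.reflect.tendsto_isMMinus_one hε hcos hsin
    (M := fun z x => mPlus ε f f' g 1 (-z) (-x)) (fun z hz => by
      have := isMMinus_reflect_iff.2 (Classical.epsilon_spec
        (hp.exists_isMPlus_one hε (z := -z) (by simpa using hz)))
      rwa [neg_neg] at this) (-x)).comp tendsto_neg_upper_lower
  simpa only [Function.comp_def, neg_neg] using h

end IsPotential

/-! ### The limit of `G` -/

theorem jPlus_zero_right (k : Fin 2) (z : ℂ) : jPlus ε f f' g k z 0 = mPlus ε f f' g k z 0 := by
  fin_cases k <;> simp [jPlus, expSigma]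

theorem jMinus_zero_right (k : Fin 2) (z : ℂ) : jMinus ε f f' g k z 0 = mMinus ε f f' g k z 0 := by
  fin_cases k <;> simp [jMinus, expSigma]

theorem continuous_cols : Continuous fun v : (Fin 2 → ℂ) × (Fin 2 → ℂ) => cols v.1 v.2 := by
  refine continuous_matrix fun i j => ?_
  fin_cases i <;> fin_cases j <;> simp [cols] <;> fun_prop

theorem tendsto_cols {l : Filter ℂ} {a b : ℂ → Fin 2 → ℂ} {a₀ b₀ : Fin 2 → ℂ}
    (ha : Tendsto a l (𝓝 a₀)) (hb : Tendsto b l (𝓝 b₀)) :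
    Tendsto (fun z => cols (a z) (b z)) l (𝓝 (cols a₀ b₀)) :=
  (continuous_cols.tendsto (a₀, b₀)).comp (ha.prodMk_nhds hb)

theorem IsPotential.exists_tendsto_G (hp : IsPotential f f' g) (hε : 0 < ε) :
    ∃ C : ℝ, C ^ 2 = 1 ∧ ∀ x, Tendsto (G ε f f' g x) (𝓝[{z | z.im ≠ 0}] 0)
      (𝓝 !![(C * Real.cos (f x / 2) : ℂ), -(C * Real.sin (f x / 2));
        C * Real.sin (f x / 2), C * Real.cos (f x / 2)]) := by
  obtain ⟨A, hA, hcosA, hsinA⟩ := hp.exists_tendsto_atBot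
  obtain ⟨C, hC, hcosC, hsinC⟩ := hp.reflect.exists_tendsto_atBot
  refine ⟨C, hC, fun x => ?_⟩
  have hA' : (A : ℂ) ^ 2 = 1 := by exact_mod_cast hA
  have hC' : (C : ℂ) ^ 2 = 1 := by exact_mod_cast hC
  have hA0 : (A : ℂ) ≠ 0 := fun h => by simp [h] at hA'
  have hC0 : (C : ℂ) ≠ 0 := fun h => by simp [h] at hC'
  have hCi : (C : ℂ)⁻¹ = C := inv_eq_of_mul_eq_one_left (by rw [← sq, hC'])
  have hcs : (Real.cos (f 0 / 2) : ℂ) ^ 2 + (Real.sin (f 0 / 2) : ℂ) ^ 2 = 1 := by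
    exact_mod_cast Real.cos_sq_add_sin_sq (f 0 / 2)
  have hset : {z : ℂ | z.im ≠ 0} = {z | 0 < z.im} ∪ {z | z.im < 0} := by
    ext z
    simp only [mem_ofPred_eq, mem_union]
    exact ne_iff_lt_or_gt.trans or_comm
  have hdet : Continuous fun B : Matrix (Fin 2) (Fin 2) ℂ => B.det := continuous_id.matrix_det
  -- Dividing by the limit `AC` of the scattering coefficient trades the sign `A` at `-∞` for the
  -- sign `C` at `+∞`, which makes the limits from the two half-planes agree.
  have hscale : ∀ a : ℂ, ((A : ℂ) * C)⁻¹ * (A * a) = C * a := fun a => by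
    rw [mul_inv, hCi]
    field_simp
  rw [hset, nhdsWithin_union, tendsto_sup]
  constructor
  · have m1 := hp.tendsto_mMinus_zero hε hcosA hsinA
    have m2 := hp.tendsto_mPlus_one hε hcosC hsinC
    have hS : Tendsto (S22 ε f f' g) (𝓝[{z | 0 < z.im}] 0) (𝓝 ((A : ℂ) * C)) := by
      have := (hdet.tendsto _).comp (tendsto_cols (m1 0) (m2 0))
      refine (this.congr fun z => ?_).trans (le_of_eq (congrArg 𝓝 ?_))
      · simp only [S22, jPlus_zero_right, jMinus_zero_right, Function.comp_apply]
      · simp only [cols, Matrix.det_fin_two_of, Matrix.cons_val_zero, Matrix.cons_val_one]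
        linear_combination (A : ℂ) * C * hcs
    have := tendsto_cols ((hS.inv₀ (mul_ne_zero hA0 hC0)).smul (m1 x)) (m2 x)
    refine (this.congr' (eventually_nhdsWithin_of_forall fun z hz => ?_)).trans
      (le_of_eq (congrArg 𝓝 ?_))
    · have hz' : 0 < z.im := hz
      simp only [G, if_pos hz']
    · simp only [cols, Pi.smul_apply, Matrix.cons_val_zero, Matrix.cons_val_one, smul_eq_mul, hscale]
  · have m1 := hp.tendsto_mPlus_zero hε hcosC hsinC
    have m2 := hp.tendsto_mMinus_one hε hcosA hsinA
    have hS : Tendsto (S11 ε f f' g) (𝓝[{z | z.im < 0}] 0) (𝓝 ((A : ℂ) * C)) := by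
      have := (hdet.tendsto _).comp (tendsto_cols (m1 0) (m2 0))
      refine (this.congr fun z => ?_).trans (le_of_eq (congrArg 𝓝 ?_))
      · simp only [S11, jPlus_zero_right, jMinus_zero_right, Function.comp_apply]
      · simp only [cols, Matrix.det_fin_two_of, Matrix.cons_val_zero, Matrix.cons_val_one]
        linear_combination (A : ℂ) * C * hcs
    have := tendsto_cols (m1 x) ((hS.inv₀ (mul_ne_zero hA0 hC0)).smul (m2 x))
    refine (this.congr' (eventually_nhdsWithin_of_forall fun z hz => ?_)).trans
      (le_of_eq (congrArg 𝓝 ?_))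
    · have hz' : ¬ 0 < z.im := not_lt.2 (le_of_lt hz)
      simp only [G, if_neg hz']
    · simp only [cols, Pi.smul_apply, Matrix.cons_val_zero, Matrix.cons_val_one, smul_eq_mul,
        mul_neg, hscale]

/-! ### From Sobolev regularity to classical potentials, and the conclusion. -/

theorem HasL1SobolevRegularity.exists_isPotential {u ux uxx ut utx : ℝ → ℝ → ℝ}
    (h : HasL1SobolevRegularity u ux uxx ut utx) (ε : ℝ) {t : ℝ} (ht : 0 ≤ t) :
    ∃ f₁' g₁ : ℝ → ℝ, (fun y => ux y t) =ᵐ[volume] f₁' ∧ (fun y => ε * ut y t) =ᵐ[volume] g₁ ∧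
      IsPotential (fun y => u y t) f₁' g₁ := by
  -- Integrability of `u_xx` and `u_tx` gives continuous representatives of `u_x` and `u_t`; the
  -- first makes `u` continuously differentiable in `x`.
  obtain ⟨f₁', hf₁, hf₁'⟩ := (h.hasDeriv_xx t ht).exists_continuous_ae_eq (h.integrable_xx t ht)
  obtain ⟨g₁, hg₁, hg₁'⟩ := (h.hasDeriv_tx t ht).exists_continuous_ae_eq (h.integrable_tx t ht)
  refine ⟨f₁', fun y => ε * g₁ y, hf₁', hg₁'.mono fun y hy => ?_,
    (h.hasDeriv_x t ht).hasDerivAt (h.integrable_x t ht) (h.continuous t ht) hf₁ hf₁', hf₁,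
    continuous_const.mul hg₁, (h.integrable_x t ht).congr hf₁',
    ((h.integrable_t t ht).congr hg₁').const_mul ε, h.integrable_one_sub_cos t ht,
    h.integrable_sin t ht⟩
  simp only at hy ⊢
  rw [hy]

end SineGordon

end

theorem mainTheorem8 (ε : ℝ) (hε : 0 < ε) (u ux uxx ut utx : ℝ → ℝ → ℝ)
    (hsol : SineGordon.IsSineGordonSolution ε u ut)
    (hreg : SineGordon.HasL1SobolevRegularity u ux uxx ut utx)
    (x t : ℝ) (ht : 0 ≤ t) :
    ∃ G₀ : Matrix (Fin 2) (Fin 2) ℂ,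
      Filter.Tendsto
        (SineGordon.G ε (fun y => u y t) (fun y => ux y t) (fun y => ε * ut y t) x)
        (nhdsWithin 0 {z : ℂ | z.im ≠ 0}) (nhds G₀) ∧
      ((Real.cos (u x t) : ℝ) : ℂ) = G₀ 0 0 * G₀ 1 1 + G₀ 0 1 * G₀ 1 0 ∧
      ((Real.cos (u x t) : ℝ) : ℂ) = 1 + 2 * G₀ 0 1 * G₀ 1 0 ∧
      ((Real.sin (u x t) : ℝ) : ℂ) = 2 * G₀ 1 0 * G₀ 1 1 ∧
      ((Real.sin (u x t) : ℝ) : ℂ) = -2 * G₀ 0 0 * G₀ 0 1 := by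
  obtain ⟨f₁', g₁, hf, hg, hp⟩ := hreg.exists_isPotential ε ht
  obtain ⟨C, hC, hG⟩ := hp.exists_tendsto_G hε
  have hC' : (C : ℂ) ^ 2 = 1 := by exact_mod_cast hC
  have hcos : ((Real.cos (u x t) : ℝ) : ℂ) = 1 - 2 * (Real.sin (u x t / 2) : ℂ) ^ 2 := by
    have := Real.cos_two_mul_eq_one_sub (u x t / 2)
    rw [show 2 * (u x t / 2) = u x t by ring] at this
    exact_mod_cast this
  have hsin : ((Real.sin (u x t) : ℝ) : ℂ)
      = 2 * (Real.sin (u x t / 2) : ℂ) * (Real.cos (u x t / 2) : ℂ) := by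
    have := Real.sin_two_mul (u x t / 2)
    rw [show 2 * (u x t / 2) = u x t by ring] at this
    exact_mod_cast this
  have hcs : (Real.cos (u x t / 2) : ℂ) ^ 2 + (Real.sin (u x t / 2) : ℂ) ^ 2 = 1 := by
    exact_mod_cast Real.cos_sq_add_sin_sq (u x t / 2)
  rw [SineGordon.G_congr hf hg]
  refine ⟨_, hG x, ?_⟩
  simp only [hcos, hsin, Matrix.of_apply, Matrix.cons_val_zero, Matrix.cons_val_one,
    Matrix.cons_val']
  generalize (Real.cos (u x t / 2) : ℂ) = c at *
  generalize (Real.sin (u x t / 2) : ℂ) = s at *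
  -- Each right-hand side is quadratic in the limit matrix, so the unknown sign enters only through
  -- `C² = 1`.
  refine ⟨?_, ?_, ?_, ?_⟩
  · linear_combination (s ^ 2 - c ^ 2) * hC' - hcs
  · linear_combination 2 * s ^ 2 * hC'
  · linear_combination -2 * s * c * hC'
  · linear_combination -2 * s * c * hC'
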